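/- All Hilbert spaces are complex and separable. A system of four subspaces $\mathcal S=(H;E_1,E_2,E_3,E_4)$ consists of a Hilbert space $H$ and four closed subspaces $E_i\subset H$. Two systems are isomorphic if there is a bounded invertible linear operator between the Hilbert spaces that maps the $i$-th subspace of the first onto the $i$-th subspace of the second for every $i$; a system is indecomposable if it is not isomorphic to a direct sum of two non-zero systems. A system is quasi-Fredholm if $E_i\cap E_j$ and $(E_i+E_j)^\perp$ are finite-dimensional for all $i\neq j$, and its defect is then $$\rho(\mathcal S)=\frac13\sum_{1\le i<j\le 4}\bigl(\dim(E_i\cap E_j)-\dim (E_i+E_j)^{\perp}\bigr).$$ For a bounded operator $T$ on a Hilbert space $K$ let $\mathcal S_T=(K\oplus K;\,K\oplus 0,\,0\oplus K,\,\{(x,Tx):x\in K\},\,\{(x,x):x\in K\})$. Let $S$ be the unilateral shift on $\ell^2(\mathbb N)$, and for $n\ge 1$ let $V=V_n$ be the operator on $\ell^2(\mathbb N)\otimes\mathbb C^n$ given by the $n\times n$ operator matrix with $S$ on the diagonal, $I$ on the first subdiagonal and $0$ elsewhere. Then for every integer $n$ there is an uncountable family of pairwise non-isomorphic indecomposable quasi-Fredholm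 systems of four subspaces with defect $n/3$. More precisely: 1. For every integer $n\ge 1$, the systems $\mathcal S_{V_n-\alpha I}$, $\alpha\in(0,1)$, are indecomposable, quasi-Fredholm, pairwise non-isomorphic, and have defect $-n/3$. 2. For every integer $n\ge 1$, the systems $\mathcal S_{V_n^*-\alpha I}$, $\alpha\in(0,1)$, are indecomposable, quasi-Fredholm, pairwise non-isomorphic, and have defect $n/3$. 3. The systems $\mathcal S_{S+3I+\alpha I}$, $\alpha\in[0,1]$, are indecomposable, quasi-Fredholm, pairwise non-isomorphic, and have defect $0$. -/

import Mathlib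

noncomputable section

universe u

/-- A system of `n` (closed) subspaces `(H; E₁, …, Eₙ)` of a separable complex Hilbert space `H`.
The subspaces are indexed from `0`. -/
structure SubspaceSystem (n : ℕ) : Type (u + 1) where
  H : Type u
  [normed : NormedAddCommGroup H]
  [inner : InnerProductSpace ℂ H]
  [complete : CompleteSpace H]
  [separable : TopologicalSpace.SeparableSpace H]
  E : Fin n → Submodule ℂ H
  isClosed_E : ∀ i, IsClosed (E i : Set H)

namespace SubspaceSystem

attribute [instance] normed inner complete separable

/-- An isomorphism of systems is a bounded bijective linear operator `φ : H → H'`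
(with bounded inverse) such that `φ(E_i) = E'_i` for all `i`. -/
def Isomorphic {n : ℕ} (𝒮 𝒯 : SubspaceSystem.{u} n) : Prop :=
  ∃ φ : 𝒮.H ≃L[ℂ] 𝒯.H, ∀ i, (φ : 𝒮.H → 𝒯.H) '' (𝒮.E i : Set 𝒮.H) = (𝒯.E i : Set 𝒯.H)

/-- The direct sum `(H ⊕ H'; E₁ ⊕ E₁', …, Eₙ ⊕ Eₙ')`, on the Hilbert space direct sum. -/
def directSum {n : ℕ} (𝒮 𝒯 : SubspaceSystem.{u} n) : SubspaceSystem.{u} n where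
  H := WithLp 2 (𝒮.H × 𝒯.H)
  separable := (WithLp.prodContinuousLinearEquiv 2 ℂ 𝒮.H 𝒯.H).symm.surjective.denseRange.separableSpace
    (WithLp.prodContinuousLinearEquiv 2 ℂ 𝒮.H 𝒯.H).symm.continuous
  E i := (𝒮.E i).comap (WithLp.fstL 2 ℂ 𝒮.H 𝒯.H).toLinearMap ⊓
    (𝒯.E i).comap (WithLp.sndL 2 ℂ 𝒮.H 𝒯.H).toLinearMap
  isClosed_E i := ((𝒮.isClosed_E i).preimage (WithLp.fstL 2 ℂ 𝒮.H 𝒯.H).continuous).inter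
    ((𝒯.isClosed_E i).preimage (WithLp.sndL 2 ℂ 𝒮.H 𝒯.H).continuous)

/-- A system is decomposable if it is isomorphic to a direct sum of two non-zero systems. -/
def Decomposable {n : ℕ} (𝒮 : SubspaceSystem.{u} n) : Prop :=
  ∃ 𝒮₁ 𝒮₂ : SubspaceSystem.{u} n,
    Nontrivial 𝒮₁.H ∧ Nontrivial 𝒮₂.H ∧ 𝒮.Isomorphic (𝒮₁.directSum 𝒮₂)

def Indecomposable {n : ℕ} (𝒮 : SubspaceSystem.{u} n) : Prop := ¬ 𝒮.Decomposable

/-- A system of four subspaces is quasi-Fredholm if `E_i ∩ E_j` and `(E_i + E_j)ᗮ` are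
finite-dimensional for all `i ≠ j`. -/
def IsQuasiFredholm (𝒮 : SubspaceSystem.{u} 4) : Prop :=
  ∀ i j : Fin 4, i ≠ j →
    FiniteDimensional ℂ ↥(𝒮.E i ⊓ 𝒮.E j) ∧ FiniteDimensional ℂ ↥(𝒮.E i ⊔ 𝒮.E j)ᗮ

/-- The defect `(1/3) ∑_{i<j} (dim (E_i ∩ E_j) - dim (E_i + E_j)ᗮ)` (meaningful for
quasi-Fredholm systems). -/
def defect (𝒮 : SubspaceSystem.{u} 4) : ℚ :=
  (1 / 3) * ∑ p : Fin 4 × Fin 4 with p.1 < p.2,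
    ((Module.finrank ℂ ↥(𝒮.E p.1 ⊓ 𝒮.E p.2) : ℚ) -
      (Module.finrank ℂ ↥(𝒮.E p.1 ⊔ 𝒮.E p.2)ᗮ : ℚ))

/-- The operator system `𝒮_T = (K ⊕ K; K ⊕ 0, 0 ⊕ K, {(x, T x)}, {(x, x)})` of a bounded
operator `T` on a separable Hilbert space `K`. The subspaces are written as kernels of the
bounded operators `(x, y) ↦ y`, `x`, `y - T x`, `y - x`. -/
def ofOperator {K : Type u} [NormedAddCommGroup K] [InnerProductSpace ℂ K] [CompleteSpace K]
    [TopologicalSpace.SeparableSpace K] (T : K →L[ℂ] K) : SubspaceSystem.{u} 4 where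
  H := WithLp 2 (K × K)
  separable := (WithLp.prodContinuousLinearEquiv 2 ℂ K K).symm.surjective.denseRange.separableSpace
    (WithLp.prodContinuousLinearEquiv 2 ℂ K K).symm.continuous
  E := ![(WithLp.sndL 2 ℂ K K).ker,
    (WithLp.fstL 2 ℂ K K).ker,
    (WithLp.sndL 2 ℂ K K - T ∘L WithLp.fstL 2 ℂ K K).ker,
    (WithLp.sndL 2 ℂ K K - WithLp.fstL 2 ℂ K K).ker]
  isClosed_E i := by
    fin_cases i <;> exact ContinuousLinearMap.isClosed_ker _

section ofOperator

variable {K : Type u} [NormedAddCommGroup K] [InnerProductSpace ℂ K] [CompleteSpace K]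
  [TopologicalSpace.SeparableSpace K]

theorem mem_ofOperator_zero (T : K →L[ℂ] K) (z : WithLp 2 (K × K)) :
    z ∈ (ofOperator T).E 0 ↔ ∃ x : K, z = WithLp.toLp 2 (x, 0) := by
  constructor
  · intro h
    exact ⟨z.fst, (WithLp.ofLp_injective 2) (Prod.ext rfl h)⟩
  · rintro ⟨x, rfl⟩
    exact (rfl : (0 : K) = 0)

theorem mem_ofOperator_one (T : K →L[ℂ] K) (z : WithLp 2 (K × K)) :
    z ∈ (ofOperator T).E 1 ↔ ∃ y : K, z = WithLp.toLp 2 (0, y) := by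
  constructor
  · intro h
    exact ⟨z.snd, (WithLp.ofLp_injective 2) (Prod.ext h rfl)⟩
  · rintro ⟨x, rfl⟩
    exact (rfl : (0 : K) = 0)

theorem mem_ofOperator_two (T : K →L[ℂ] K) (z : WithLp 2 (K × K)) :
    z ∈ (ofOperator T).E 2 ↔ ∃ x : K, z = WithLp.toLp 2 (x, T x) := by
  constructor
  · intro h
    exact ⟨z.fst, (WithLp.ofLp_injective 2) (Prod.ext rfl (sub_eq_zero.1 h))⟩
  · rintro ⟨x, rfl⟩
    exact sub_self (T x)

theorem mem_ofOperator_three (T : K →L[ℂ] K) (z : WithLp 2 (K × K)) :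
    z ∈ (ofOperator T).E 3 ↔ ∃ x : K, z = WithLp.toLp 2 (x, x) := by
  constructor
  · intro h
    exact ⟨z.fst, (WithLp.ofLp_injective 2) (Prod.ext rfl (sub_eq_zero.1 h))⟩
  · rintro ⟨x, rfl⟩
    exact sub_self x

end ofOperator

end SubspaceSystem

/-- The Hilbert space `ℓ²(ℕ)`. -/
abbrev EllTwo : Type := lp (fun _ : ℕ => ℂ) 2

instance EllTwo.separableSpace : TopologicalSpace.SeparableSpace EllTwo := by
  have hs : TopologicalSpace.IsSeparable
      (Set.range fun i : ℕ => (lp.single 2 i (1 : ℂ) : EllTwo)) :=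
    (Set.countable_range _).isSeparable
  have hs' := (hs.span (R := ℂ)).closure
  have huniv : closure (Submodule.span ℂ
      (Set.range fun i : ℕ => (lp.single 2 i (1 : ℂ) : EllTwo)) : Set EllTwo) = Set.univ := by
    refine Set.eq_univ_of_forall fun f => ?_
    refine mem_closure_of_tendsto (lp.hasSum_single ENNReal.ofNat_ne_top f)
      (Filter.Eventually.of_forall fun s => ?_)
    refine Submodule.sum_mem _ fun i _ => ?_
    have : (lp.single 2 i (f i) : EllTwo) = f i • (lp.single 2 i (1 : ℂ) : EllTwo) := by
      rw [← lp.single_smul]; simp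
    rw [this]
    exact Submodule.smul_mem _ _ (Submodule.subset_span ⟨i, rfl⟩)
  rw [huniv] at hs'
  exact TopologicalSpace.isSeparable_univ_iff.1 hs'

/-- The sequence `(0, x₀, x₁, …)`. -/
def shiftSeq (x : ℕ → ℂ) : ℕ → ℂ
  | 0 => 0
  | k + 1 => x k

theorem hasSum_shiftSeq (x : EllTwo) :
    HasSum (fun k => ‖shiftSeq x k‖ ^ (2 : ENNReal).toReal) (‖x‖ ^ (2 : ENNReal).toReal) := by
  have h := lp.hasSum_norm (p := 2) (by norm_num) x
  refine (hasSum_nat_add_iff' 1).1 ?_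
  simpa [shiftSeq] using h

/-- The unilateral shift `S (x₀, x₁, …) = (0, x₀, x₁, …)` on `ℓ²(ℕ)`. -/
def unilateralShift : EllTwo →L[ℂ] EllTwo :=
  LinearMap.mkContinuous
    { toFun := fun x => ⟨shiftSeq x, memℓp_gen (hasSum_shiftSeq x).summable⟩
      map_add' := fun x y => by
        ext k
        cases k
        · exact (add_zero (0 : ℂ)).symm
        · rfl
      map_smul' := fun c x => by
        ext k
        cases k <;> simp [shiftSeq] }
    1
    (fun x => by
      rw [one_mul]
      refine le_of_eq (Real.rpow_left_injOn (x := (2 : ENNReal).toReal) (by norm_num)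
        (norm_nonneg _) (norm_nonneg _) ?_)
      exact (lp.hasSum_norm (p := 2) (by norm_num) _).unique (hasSum_shiftSeq x))

/-- The Hilbert space `ℓ²(ℕ) ⊗ ℂⁿ`, as the Hilbert space direct sum of `n` copies of `ℓ²(ℕ)`. -/
abbrev EllTwoPow (n : ℕ) : Type := PiLp 2 (fun _ : Fin n => EllTwo)

instance EllTwoPow.separableSpace (n : ℕ) : TopologicalSpace.SeparableSpace (EllTwoPow n) :=
  (PiLp.continuousLinearEquiv 2 ℂ (fun _ : Fin n => EllTwo)).symm.surjective.denseRange.separableSpace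
    (PiLp.continuousLinearEquiv 2 ℂ (fun _ : Fin n => EllTwo)).symm.continuous

/-- The operator on `ℓ²(ℕ) ⊗ ℂⁿ` given by an `n × n` matrix of operators on `ℓ²(ℕ)`:
`(A x)_i = ∑_j A_{ij} x_j`. -/
def blockOperator {n : ℕ} (A : Matrix (Fin n) (Fin n) (EllTwo →L[ℂ] EllTwo)) :
    EllTwoPow n →L[ℂ] EllTwoPow n :=
  (PiLp.continuousLinearEquiv 2 ℂ (fun _ : Fin n => EllTwo)).symm.toContinuousLinearMap ∘L
    ContinuousLinearMap.pi fun i =>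
      ∑ j, A i j ∘L PiLp.proj (𝕜 := ℂ) 2 (fun _ : Fin n => EllTwo) j

/-- The lower triangular operator matrix `V` with the shift `S` on the diagonal and the identity
on the first subdiagonal. -/
def blockShift (n : ℕ) : EllTwoPow n →L[ℂ] EllTwoPow n :=
  blockOperator fun i j =>
    if i = j then unilateralShift
    else if (i : ℕ) = (j : ℕ) + 1 then ContinuousLinearMap.id ℂ EllTwo
    else 0

end

/-! A bounded map between operator systems that respects all four subspaces has the form `A ⊕ A`:
the two axes make it diagonal, the diagonal makes the two entries equal, and the graph makes `A`
intertwine the operators (`exists_intertwining`). So isomorphic systems come from similar operators,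
and a decomposition yields a non-trivial idempotent in the commutant of `T`. Similar operators have
the same spectrum, and a non-empty bounded set is not a translate of itself by a non-zero number;
this separates the members of each family.

Of the six pairs of subspaces only graph/horizontal axis and graph/diagonal contribute to the
defect. Three times the defect is `dim ker T - dim ker T*` plus the same difference for `T - 1`
(`defect_ofOperator`). For `T = V - α` with `0 < α < 1`, `V` has no non-zero eigenvalue, and `V*`
has none outside the closed disc, so `T - 1` contributes nothing. Inside the disc, an eigenvector of
`V*` is determined by the `n` initial coordinates of its blocks, which are arbitrary, so `ker T*`
has dimension `n`. Adjoints reverse the sign, and `S + 3 + α` has all four kernels trivial.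

What remains is that only trivial idempotents commute with `V`. Write `V = D + N` with `D = S ⊗ I`
isometric, `N` nilpotent and `DN = ND`. Whatever commutes with `V` commutes with `D` and `N`
separately (`commute_isometry_of_commute_add`). An idempotent therefore restricts to `ker N`, a copy
of `ℓ²`, where it commutes with `S` and so acts as multiplication by an idempotent of the domain
`ℂ⟦X⟧`: it is `0` or `1` there. Nilpotency of `N` extends this to the whole space
(`eq_zero_of_idempotent_of_ker`). -/

namespace SubspaceSystem

/-! ### Morphisms of operator systems: similarity, spectra, idempotents -/

section General

variable {K : Type u} [NormedAddCommGroup K] [InnerProductSpace ℂ K] [CompleteSpace K]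
  [TopologicalSpace.SeparableSpace K]

theorem Isomorphic.refl {n : ℕ} (𝒮 : SubspaceSystem.{u} n) : 𝒮.Isomorphic 𝒮 :=
  ⟨ContinuousLinearEquiv.refl ℂ 𝒮.H, fun i => by simp⟩

/-- A bounded operator between the spaces of two operator systems that respects the four
subspaces is of the form `A ⊕ A`, where `A` intertwines the two operators. -/
theorem exists_intertwining {T T' : K →L[ℂ] K}
    (Φ : WithLp 2 (K × K) →L[ℂ] WithLp 2 (K × K))
    (hΦ : ∀ i, ∀ z ∈ (ofOperator T).E i, Φ z ∈ (ofOperator T').E i) :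
    ∃ A : K →L[ℂ] K, (∀ z, Φ z = WithLp.toLp 2 (A z.fst, A z.snd)) ∧
      ∀ x, A (T x) = T' (A x) := by
  let e := (WithLp.prodContinuousLinearEquiv 2 ℂ K K).symm.toContinuousLinearMap
  let A : K →L[ℂ] K := WithLp.fstL 2 ℂ K K ∘L Φ ∘L e ∘L ContinuousLinearMap.inl ℂ K K
  let B : K →L[ℂ] K := WithLp.sndL 2 ℂ K K ∘L Φ ∘L e ∘L ContinuousLinearMap.inr ℂ K K
  have hA (x : K) : Φ (WithLp.toLp 2 (x, 0)) = WithLp.toLp 2 (A x, 0) := by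
    obtain ⟨w, hw⟩ := (mem_ofOperator_zero T' _).1
      (hΦ 0 _ ((mem_ofOperator_zero T _).2 ⟨x, rfl⟩))
    have : A x = w := congrArg WithLp.fst hw
    rw [hw, this]
  have hB (x : K) : Φ (WithLp.toLp 2 (0, x)) = WithLp.toLp 2 (0, B x) := by
    obtain ⟨w, hw⟩ := (mem_ofOperator_one T' _).1
      (hΦ 1 _ ((mem_ofOperator_one T _).2 ⟨x, rfl⟩))
    have : B x = w := congrArg WithLp.snd hw
    rw [hw, this]
  have hAB (x y : K) : Φ (WithLp.toLp 2 (x, y)) = WithLp.toLp 2 (A x, B y) := by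
    have h : (WithLp.toLp 2 (x, y) : WithLp 2 (K × K)) =
        WithLp.toLp 2 (x, 0) + WithLp.toLp 2 (0, y) := by
      rw [← WithLp.toLp_add]; simp
    rw [h, map_add, hA, hB, ← WithLp.toLp_add]; simp
  have hd (x : K) : B x = A x := by
    obtain ⟨w, hw⟩ := (mem_ofOperator_three T' _).1
      (hΦ 3 _ ((mem_ofOperator_three T _).2 ⟨x, rfl⟩))
    rw [hAB] at hw
    exact (congrArg WithLp.snd hw).trans (congrArg WithLp.fst hw).symm
  refine ⟨A, fun z => ?_, fun x => ?_⟩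
  · rw [← hd z.snd]
    exact hAB z.fst z.snd
  · obtain ⟨w, hw⟩ := (mem_ofOperator_two T' _).1
      (hΦ 2 _ ((mem_ofOperator_two T _).2 ⟨x, rfl⟩))
    rw [hAB, hd] at hw
    have h1 : A x = w := congrArg WithLp.fst hw
    have h2 : A (T x) = T' w := congrArg WithLp.snd hw
    rw [h2, h1]

/-- Both the isomorphism and its inverse respect the subspaces, so each is diagonal; comparing first
components shows that the two diagonal entries are mutually inverse. -/
theorem Isomorphic.exists_conj {T T' : K →L[ℂ] K}
    (h : (ofOperator T).Isomorphic (ofOperator T')) :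
    ∃ W : (K →L[ℂ] K)ˣ, T' = W * T * (↑W⁻¹ : K →L[ℂ] K) := by
  obtain ⟨φ, hφ⟩ := h
  obtain ⟨A, hA, hAT⟩ := exists_intertwining (T := T) (T' := T')
    (φ.toContinuousLinearMap) (fun i z hz => by
      have : φ z ∈ (φ : (ofOperator T).H → (ofOperator T').H) '' ((ofOperator T).E i : Set _) :=
        ⟨z, hz, rfl⟩
      rw [hφ i] at this
      exact this)
  obtain ⟨B, hB, -⟩ := exists_intertwining (T := T') (T' := T)
    (φ.symm.toContinuousLinearMap) (fun i z hz => by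
      have : z ∈ (φ : (ofOperator T).H → (ofOperator T').H) '' ((ofOperator T).E i : Set _) := by
        rw [hφ i]; exact hz
      obtain ⟨w, hw, rfl⟩ := this
      have h : φ.symm (φ w) = w := φ.symm_apply_apply w
      exact h.symm ▸ hw)
  have hAB : A * B = 1 := by
    ext x
    have h1 : φ (φ.symm (WithLp.toLp 2 (x, 0))) = WithLp.toLp 2 (x, 0) :=
      φ.apply_symm_apply _
    have h2 : φ.symm (WithLp.toLp 2 (x, 0)) = WithLp.toLp 2 (B x, B 0) := hB _
    have h3 : φ (WithLp.toLp 2 (B x, B 0)) = WithLp.toLp 2 (A (B x), A (B 0)) := hA _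
    rw [h2, h3] at h1
    exact congrArg WithLp.fst h1
  have hBA : B * A = 1 := by
    ext x
    have h1 : φ.symm (φ (WithLp.toLp 2 (x, 0))) = WithLp.toLp 2 (x, 0) :=
      φ.symm_apply_apply _
    have h2 : φ (WithLp.toLp 2 (x, 0)) = WithLp.toLp 2 (A x, A 0) := hA _
    have h3 : φ.symm (WithLp.toLp 2 (A x, A 0)) = WithLp.toLp 2 (B (A x), B (A 0)) := hB _
    rw [h2, h3] at h1
    exact congrArg WithLp.fst h1
  refine ⟨⟨A, B, hAB, hBA⟩, ?_⟩
  have h : A * T = T' * A := ContinuousLinearMap.ext hAT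
  change T' = A * T * B
  rw [h, mul_assoc, hAB, mul_one]

open scoped Pointwise in
/-- Distinct translates of a bounded operator are never similar, since the spectrum is nonempty
and bounded. -/
theorem not_isomorphic_add_smul [Nontrivial K] (T : K →L[ℂ] K) {a b : ℂ} (hab : a ≠ b) :
    ¬ (ofOperator (T + a • 1)).Isomorphic (ofOperator (T + b • 1)) := by
  intro h
  obtain ⟨W, hW⟩ := h.exists_conj
  have hs : spectrum ℂ (T + b • 1) = spectrum ℂ (T + a • 1) := by
    rw [hW, spectrum.units_conjugate]
  have key (c : ℂ) : T + c • (1 : K →L[ℂ] K) = algebraMap ℂ (K →L[ℂ] K) c + T := by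
    rw [Algebra.algebraMap_eq_smul_one, add_comm]
  rw [key, key, ← spectrum.singleton_add_eq, ← spectrum.singleton_add_eq] at hs
  -- Equality of the translated spectra makes the spectrum of `T` stable under `z ↦ z + (a - b)`, so
  -- it would contain an unbounded progression.
  have hstep (z : ℂ) (hz : z ∈ spectrum ℂ T) : z + (a - b) ∈ spectrum ℂ T := by
    have : a + z ∈ ({b} : Set ℂ) + spectrum ℂ T := by
      exact hs ▸ Set.add_mem_add rfl hz
    obtain ⟨c, hc, w, hw, hwz⟩ := this
    have hc : c = b := hc
    have : w = z + (a - b) := by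
      have : c + w = a + z := hwz
      linear_combination this - hc
    exact this ▸ hw
  obtain ⟨z, hz⟩ := spectrum.nonempty T
  have hmem (k : ℕ) : z + k * (a - b) ∈ spectrum ℂ T := by
    induction k with
    | zero => simpa using hz
    | succ k ih =>
      have := hstep _ ih
      convert this using 1
      push_cast; ring
  obtain ⟨C, hC⟩ := (spectrum.isCompact (𝕜 := ℂ) T).isBounded.exists_norm_le
  have hpos : 0 < ‖a - b‖ := norm_pos_iff.2 (sub_ne_zero.2 hab)
  obtain ⟨k, hk⟩ := exists_nat_gt ((C + ‖z‖) / ‖a - b‖)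
  rw [div_lt_iff₀ hpos] at hk
  have h1 := hC _ (hmem k)
  have h2 : ‖(k : ℂ) * (a - b)‖ ≤ ‖z + k * (a - b)‖ + ‖z‖ := by
    simpa using norm_sub_le (z + k * (a - b)) z
  rw [norm_mul, Complex.norm_natCast] at h2
  linarith

/-- An operator system is indecomposable if the operator commutes with trivial idempotents
only. -/
theorem indecomposable_ofOperator {T : K →L[ℂ] K}
    (hT : ∀ A : K →L[ℂ] K, A * A = A → Commute A T → A = 0 ∨ A = 1) :
    (ofOperator T).Indecomposable := by
  rintro ⟨𝒮₁, 𝒮₂, h₁, h₂, φ, hφ⟩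
  let ψ : WithLp 2 (K × K) ≃L[ℂ] 𝒮₁.H × 𝒮₂.H :=
    φ.trans (WithLp.prodContinuousLinearEquiv 2 ℂ 𝒮₁.H 𝒮₂.H)
  have hψ (i) (z : WithLp 2 (K × K)) :
      z ∈ (ofOperator T).E i ↔ (ψ z).1 ∈ 𝒮₁.E i ∧ (ψ z).2 ∈ 𝒮₂.E i := by
    have h : φ z ∈ (𝒮₁.directSum 𝒮₂).E i ↔ (ψ z).1 ∈ 𝒮₁.E i ∧ (ψ z).2 ∈ 𝒮₂.E i := Iff.rfl
    refine Iff.trans ?_ h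
    refine (φ.injective.mem_set_image (s := ((ofOperator T).E i : Set _))).symm.trans ?_
    rw [hφ i]
    exact Iff.rfl
  -- The projection onto the first summand, transported to `K ⊕ K`. It preserves each subspace
  -- because each splits along the sum; were it `0` or `1`, one summand would vanish.
  let Φ : WithLp 2 (K × K) →L[ℂ] WithLp 2 (K × K) := ψ.symm.toContinuousLinearMap ∘L
    ContinuousLinearMap.inl ℂ 𝒮₁.H 𝒮₂.H ∘L ContinuousLinearMap.fst ℂ 𝒮₁.H 𝒮₂.H ∘L
    ψ.toContinuousLinearMap
  have hΦ (z) : ψ (Φ z) = ((ψ z).1, 0) := ψ.apply_symm_apply _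
  obtain ⟨A, hA, hAT⟩ := exists_intertwining (T := T) (T' := T) Φ (fun i z hz => by
    refine (hψ i _).2 ?_
    have h := hΦ z
    exact h ▸ ⟨((hψ i z).1 hz).1, zero_mem _⟩)
  have hΦΦ (z) : Φ (Φ z) = Φ z := by
    apply ψ.injective
    rw [hΦ, hΦ]
  have hAA : A * A = A := by
    ext x
    have := hΦΦ (WithLp.toLp 2 (x, 0))
    rw [hA, hA] at this
    exact congrArg WithLp.fst this
  obtain ⟨x₁, hx₁⟩ := exists_ne (0 : 𝒮₁.H)
  obtain ⟨x₂, hx₂⟩ := exists_ne (0 : 𝒮₂.H)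
  rcases hT A hAA (ContinuousLinearMap.ext hAT) with rfl | rfl
  · have h := hΦ (ψ.symm (x₁, 0))
    rw [hA] at h
    have h0 : (WithLp.toLp 2 ((0 : K), (0 : K)) : WithLp 2 (K × K)) = 0 := rfl
    simp only [zero_apply, h0, map_zero, ψ.apply_symm_apply] at h
    exact hx₁ (congrArg Prod.fst h).symm
  · have h := hΦ (ψ.symm (0, x₂))
    rw [hA] at h
    have h0 : (WithLp.toLp 2 ((1 : K →L[ℂ] K) (ψ.symm (0, x₂)).fst,
      (1 : K →L[ℂ] K) (ψ.symm (0, x₂)).snd) : WithLp 2 (K × K)) = ψ.symm (0, x₂) := rfl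
    rw [h0, ψ.apply_symm_apply] at h
    exact hx₂ (congrArg Prod.snd h)

end General

/-! ### Intersections, orthogonal complements and the defect -/

section Defect

variable {K : Type u} [NormedAddCommGroup K] [InnerProductSpace ℂ K] [CompleteSpace K]
  [TopologicalSpace.SeparableSpace K] (T : K →L[ℂ] K)

/-- Since `(E_i + E_j)ᗮ = E_iᗮ ⊓ E_jᗮ`, linear equations for the four complements suffice to compute
all six codimension terms. -/
theorem mem_ofOperator_zero_orthogonal (z : WithLp 2 (K × K)) :
    z ∈ ((ofOperator T).E 0)ᗮ ↔ z.fst = 0 := by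
  refine (Submodule.mem_orthogonal (E := (ofOperator T).H) _ _).trans ?_
  constructor
  · intro h
    have := h (WithLp.toLp 2 (z.fst, 0)) ((mem_ofOperator_zero T _).2 ⟨_, rfl⟩)
    have h' : Inner.inner ℂ z.fst z.fst + Inner.inner ℂ (0 : K) z.snd = (0 : ℂ) := this
    simpa using h'
  · intro h u hu
    obtain ⟨x, rfl⟩ := (mem_ofOperator_zero T _).1 hu
    change Inner.inner ℂ x z.fst + Inner.inner ℂ (0 : K) z.snd = (0 : ℂ)
    simp [h]

theorem mem_ofOperator_one_orthogonal (z : WithLp 2 (K × K)) :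
    z ∈ ((ofOperator T).E 1)ᗮ ↔ z.snd = 0 := by
  refine (Submodule.mem_orthogonal (E := (ofOperator T).H) _ _).trans ?_
  constructor
  · intro h
    have := h (WithLp.toLp 2 (0, z.snd)) ((mem_ofOperator_one T _).2 ⟨_, rfl⟩)
    have h' : Inner.inner ℂ (0 : K) z.fst + Inner.inner ℂ z.snd z.snd = (0 : ℂ) := this
    simpa using h'
  · intro h u hu
    obtain ⟨x, rfl⟩ := (mem_ofOperator_one T _).1 hu
    change Inner.inner ℂ (0 : K) z.fst + Inner.inner ℂ x z.snd = (0 : ℂ)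
    simp [h]

theorem mem_ofOperator_two_orthogonal (z : WithLp 2 (K × K)) :
    z ∈ ((ofOperator T).E 2)ᗮ ↔ z.fst + T.adjoint z.snd = 0 := by
  have key (x : K) : (Inner.inner ℂ x z.fst + Inner.inner ℂ (T x) z.snd : ℂ) =
      Inner.inner ℂ x (z.fst + T.adjoint z.snd) := by
    rw [inner_add_right, ContinuousLinearMap.adjoint_inner_right]
  refine (Submodule.mem_orthogonal (E := (ofOperator T).H) _ _).trans ?_
  constructor
  · intro h
    refine ext_inner_left ℂ fun x => ?_
    have := h (WithLp.toLp 2 (x, T x)) ((mem_ofOperator_two T _).2 ⟨_, rfl⟩)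
    rw [← key, inner_zero_right]
    exact this
  · intro h u hu
    obtain ⟨x, rfl⟩ := (mem_ofOperator_two T _).1 hu
    change Inner.inner ℂ x z.fst + Inner.inner ℂ (T x) z.snd = (0 : ℂ)
    rw [key, h, inner_zero_right]

theorem mem_ofOperator_three_orthogonal (z : WithLp 2 (K × K)) :
    z ∈ ((ofOperator T).E 3)ᗮ ↔ z.fst + z.snd = 0 := by
  refine (Submodule.mem_orthogonal (E := (ofOperator T).H) _ _).trans ?_
  constructor
  · intro h
    refine ext_inner_left ℂ fun x => ?_
    have := h (WithLp.toLp 2 (x, x)) ((mem_ofOperator_three T _).2 ⟨_, rfl⟩)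
    rw [inner_add_right, inner_zero_right]
    exact this
  · intro h u hu
    obtain ⟨x, rfl⟩ := (mem_ofOperator_three T _).1 hu
    change Inner.inner ℂ x z.fst + Inner.inner ℂ x z.snd = (0 : ℂ)
    rw [← inner_add_right, h, inner_zero_right]

/-- The embedding `x ↦ (a x, b x)` of `K` into `K ⊕ K`. -/
noncomputable def lineEmbedding (K : Type u) [NormedAddCommGroup K]
    [InnerProductSpace ℂ K] (a b : ℂ) :
    K →ₗ[ℂ] WithLp 2 (K × K) where
  toFun x := WithLp.toLp 2 (a • x, b • x)
  map_add' x y := by rw [← WithLp.toLp_add]; simp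
  map_smul' c x := by rw [← WithLp.toLp_smul]; simp [smul_comm c]

theorem lineEmbedding_injective {K : Type u} [NormedAddCommGroup K]
    [InnerProductSpace ℂ K] {a b : ℂ} (h : b ≠ 0 ∨ a ≠ 0) :
    Function.Injective (lineEmbedding K a b) := by
  intro x y hxy
  rcases h with h | h
  · have : b • x = b • y := congrArg WithLp.snd hxy
    exact smul_right_injective K h this
  · have : a • x = a • y := congrArg WithLp.fst hxy
    exact smul_right_injective K h this

/-- The pairs (0,1), (0,3), (1,2), (1,3) contribute nothing, whatever `T` is: each consists of two
graphs over a common axis whose difference is invertible, or of an axis and its complement. -/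
theorem ofOperator_inf_zero_one : (ofOperator T).E 0 ⊓ (ofOperator T).E 1 = ⊥ := by
  refine (Submodule.eq_bot_iff _).2 fun z ⟨h0, h1⟩ => ?_
  obtain ⟨x, rfl⟩ := (mem_ofOperator_zero T _).1 h0
  obtain ⟨y, hy⟩ := (mem_ofOperator_one T _).1 h1
  have : x = 0 := congrArg WithLp.fst hy
  rw [this]; rfl

theorem ofOperator_inf_zero_three : (ofOperator T).E 0 ⊓ (ofOperator T).E 3 = ⊥ := by
  refine (Submodule.eq_bot_iff _).2 fun z ⟨h0, h1⟩ => ?_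
  obtain ⟨x, rfl⟩ := (mem_ofOperator_zero T _).1 h0
  obtain ⟨y, hy⟩ := (mem_ofOperator_three T _).1 h1
  have h1 : x = y := congrArg WithLp.fst hy
  have h2 : 0 = y := congrArg WithLp.snd hy
  rw [h1, ← h2]; rfl

theorem ofOperator_inf_one_two : (ofOperator T).E 1 ⊓ (ofOperator T).E 2 = ⊥ := by
  refine (Submodule.eq_bot_iff _).2 fun z ⟨h0, h1⟩ => ?_
  obtain ⟨x, rfl⟩ := (mem_ofOperator_one T _).1 h0
  obtain ⟨y, hy⟩ := (mem_ofOperator_two T _).1 h1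
  have h1 : 0 = y := congrArg WithLp.fst hy
  have h2 : x = T y := congrArg WithLp.snd hy
  rw [h2, ← h1, map_zero]; rfl

theorem ofOperator_inf_one_three : (ofOperator T).E 1 ⊓ (ofOperator T).E 3 = ⊥ := by
  refine (Submodule.eq_bot_iff _).2 fun z ⟨h0, h1⟩ => ?_
  obtain ⟨x, rfl⟩ := (mem_ofOperator_one T _).1 h0
  obtain ⟨y, hy⟩ := (mem_ofOperator_three T _).1 h1
  have h1 : 0 = y := congrArg WithLp.fst hy
  have h2 : x = y := congrArg WithLp.snd hy
  rw [h2, ← h1]; rfl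

/-- Writing the space as an injective image of a kernel transfers both finite-dimensionality and
dimension at once. -/
theorem ofOperator_inf_zero_two :
    (ofOperator T).E 0 ⊓ (ofOperator T).E 2 =
      (LinearMap.ker (T : K →ₗ[ℂ] K)).map (lineEmbedding K 1 0) := by
  refine Submodule.ext fun z => ⟨fun ⟨h0, h1⟩ => ?_, ?_⟩
  · obtain ⟨x, rfl⟩ := (mem_ofOperator_zero T _).1 h0
    obtain ⟨y, hy⟩ := (mem_ofOperator_two T _).1 h1
    have h1 : x = y := congrArg WithLp.fst hy
    have h2 : 0 = T y := congrArg WithLp.snd hy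
    refine ⟨x, ?_, by simp [lineEmbedding]⟩
    rw [h1]; exact h2.symm
  · rintro ⟨x, hx, rfl⟩
    have hx : T x = 0 := hx
    refine ⟨(mem_ofOperator_zero T _).2 ⟨x, by simp [lineEmbedding]⟩,
      (mem_ofOperator_two T _).2 ⟨x, by simp [lineEmbedding, hx]⟩⟩

theorem ofOperator_inf_two_three :
    (ofOperator T).E 2 ⊓ (ofOperator T).E 3 =
      (LinearMap.ker ((T - 1 : K →L[ℂ] K) : K →ₗ[ℂ] K)).map (lineEmbedding K 1 1) := by
  refine Submodule.ext fun z => ⟨fun ⟨h0, h1⟩ => ?_, ?_⟩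
  · obtain ⟨x, rfl⟩ := (mem_ofOperator_two T _).1 h0
    obtain ⟨y, hy⟩ := (mem_ofOperator_three T _).1 h1
    have h1 : x = y := congrArg WithLp.fst hy
    have h2 : T x = y := congrArg WithLp.snd hy
    refine ⟨x, sub_eq_zero.2 (h2.trans h1.symm), ?_⟩
    rw [h2.trans h1.symm]
    simp [lineEmbedding]
  · rintro ⟨x, hx, rfl⟩
    have hx : T x = x := sub_eq_zero.1 hx
    refine ⟨(mem_ofOperator_two T _).2 ⟨x, by simp [lineEmbedding, hx]⟩,
      (mem_ofOperator_three T _).2 ⟨x, by simp [lineEmbedding]⟩⟩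

theorem ofOperator_orthogonal_zero_one :
    ((ofOperator T).E 0 ⊔ (ofOperator T).E 1)ᗮ = ⊥ := by
  rw [← Submodule.inf_orthogonal]
  refine (Submodule.eq_bot_iff _).2 fun z ⟨h0, h1⟩ => ?_
  exact WithLp.ofLp_injective 2 (Prod.ext ((mem_ofOperator_zero_orthogonal T z).1 h0)
    ((mem_ofOperator_one_orthogonal T z).1 h1))

theorem ofOperator_orthogonal_zero_three :
    ((ofOperator T).E 0 ⊔ (ofOperator T).E 3)ᗮ = ⊥ := by
  rw [← Submodule.inf_orthogonal]
  refine (Submodule.eq_bot_iff _).2 fun z ⟨h0, h1⟩ => ?_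
  have h0 := (mem_ofOperator_zero_orthogonal T z).1 h0
  have h1 := (mem_ofOperator_three_orthogonal T z).1 h1
  rw [h0, zero_add] at h1
  exact WithLp.ofLp_injective 2 (Prod.ext h0 h1)

theorem ofOperator_orthogonal_one_two :
    ((ofOperator T).E 1 ⊔ (ofOperator T).E 2)ᗮ = ⊥ := by
  rw [← Submodule.inf_orthogonal]
  refine (Submodule.eq_bot_iff _).2 fun z ⟨h0, h1⟩ => ?_
  have h0 := (mem_ofOperator_one_orthogonal T z).1 h0
  have h1 := (mem_ofOperator_two_orthogonal T z).1 h1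
  rw [h0, map_zero, add_zero] at h1
  exact WithLp.ofLp_injective 2 (Prod.ext h1 h0)

theorem ofOperator_orthogonal_one_three :
    ((ofOperator T).E 1 ⊔ (ofOperator T).E 3)ᗮ = ⊥ := by
  rw [← Submodule.inf_orthogonal]
  refine (Submodule.eq_bot_iff _).2 fun z ⟨h0, h1⟩ => ?_
  have h0 := (mem_ofOperator_one_orthogonal T z).1 h0
  have h1 := (mem_ofOperator_three_orthogonal T z).1 h1
  rw [h0, add_zero] at h1
  exact WithLp.ofLp_injective 2 (Prod.ext h1 h0)

theorem ofOperator_orthogonal_zero_two :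
    ((ofOperator T).E 0 ⊔ (ofOperator T).E 2)ᗮ =
      (LinearMap.ker (T.adjoint : K →ₗ[ℂ] K)).map (lineEmbedding K 0 1) := by
  rw [← Submodule.inf_orthogonal]
  refine Submodule.ext fun z => ⟨fun ⟨h0, h1⟩ => ?_, ?_⟩
  · have h0 := (mem_ofOperator_zero_orthogonal T z).1 h0
    have h1 := (mem_ofOperator_two_orthogonal T z).1 h1
    rw [h0, zero_add] at h1
    refine ⟨z.snd, h1, WithLp.ofLp_injective 2 (Prod.ext ?_ ?_)⟩
    · simp [lineEmbedding]; exact h0.symm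
    · simp [lineEmbedding]; rfl
  · rintro ⟨x, hx, rfl⟩
    have hx : T.adjoint x = 0 := hx
    exact ⟨(mem_ofOperator_zero_orthogonal T _).2 (by simp [lineEmbedding]),
      (mem_ofOperator_two_orthogonal T _).2 (by simp [lineEmbedding, hx])⟩

theorem ofOperator_orthogonal_two_three :
    ((ofOperator T).E 2 ⊔ (ofOperator T).E 3)ᗮ =
      (LinearMap.ker ((T.adjoint - 1 : K →L[ℂ] K) : K →ₗ[ℂ] K)).map
        (lineEmbedding K (-1) 1) := by
  rw [← Submodule.inf_orthogonal]
  refine Submodule.ext fun z => ⟨fun ⟨h0, h1⟩ => ?_, ?_⟩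
  · have h0 := (mem_ofOperator_two_orthogonal T z).1 h0
    have h1 := eq_neg_of_add_eq_zero_left ((mem_ofOperator_three_orthogonal T z).1 h1)
    rw [h1] at h0
    refine ⟨z.snd, ?_, WithLp.ofLp_injective 2 (Prod.ext ?_ ?_)⟩
    · refine sub_eq_zero.2 ?_
      exact (neg_add_eq_zero.1 h0).symm
    · simp [lineEmbedding]; exact h1.symm
    · simp [lineEmbedding]; rfl
  · rintro ⟨x, hx, rfl⟩
    have hx : T.adjoint x = x := sub_eq_zero.1 hx
    exact ⟨(mem_ofOperator_two_orthogonal T _).2 (by simp [lineEmbedding, hx]),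
      (mem_ofOperator_three_orthogonal T _).2 (by simp [lineEmbedding])⟩

theorem finrank_of_eq_map {V W : Type*} [AddCommGroup V] [Module ℂ V] [AddCommGroup W]
    [Module ℂ W] {f : V →ₗ[ℂ] W} (hf : Function.Injective f) {p : Submodule ℂ V}
    {q : Submodule ℂ W} (h : q = p.map f) : Module.finrank ℂ q = Module.finrank ℂ p :=
  h ▸ (Submodule.equivMapOfInjective f hf p).finrank_eq.symm

theorem finiteDimensional_of_eq_map {V W : Type*} [AddCommGroup V] [Module ℂ V] [AddCommGroup W]
    [Module ℂ W] {f : V →ₗ[ℂ] W} {p : Submodule ℂ V} {q : Submodule ℂ W} (h : q = p.map f)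
    [FiniteDimensional ℂ p] : FiniteDimensional ℂ q :=
  h ▸ Module.Finite.map p f

theorem isQuasiFredholm_ofOperator
    (h₁ : FiniteDimensional ℂ (LinearMap.ker (T : K →ₗ[ℂ] K)))
    (h₂ : FiniteDimensional ℂ (LinearMap.ker (T.adjoint : K →ₗ[ℂ] K)))
    (h₃ : FiniteDimensional ℂ (LinearMap.ker ((T - 1 : K →L[ℂ] K) : K →ₗ[ℂ] K)))
    (h₄ : FiniteDimensional ℂ (LinearMap.ker ((T.adjoint - 1 : K →L[ℂ] K) : K →ₗ[ℂ] K))) :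
    (ofOperator T).IsQuasiFredholm := by
  have key (i j : Fin 4) (hij : i < j) :
      FiniteDimensional ℂ ↥((ofOperator T).E i ⊓ (ofOperator T).E j) ∧
        FiniteDimensional ℂ ↥((ofOperator T).E i ⊔ (ofOperator T).E j)ᗮ := by
    fin_cases i <;> fin_cases j <;> first | exact absurd hij (by decide) | skip
    · exact ⟨ofOperator_inf_zero_one T ▸ inferInstance,
        ofOperator_orthogonal_zero_one T ▸ inferInstance⟩
    · exact ⟨finiteDimensional_of_eq_map (ofOperator_inf_zero_two T),
        finiteDimensional_of_eq_map (ofOperator_orthogonal_zero_two T)⟩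
    · exact ⟨ofOperator_inf_zero_three T ▸ inferInstance,
        ofOperator_orthogonal_zero_three T ▸ inferInstance⟩
    · exact ⟨ofOperator_inf_one_two T ▸ inferInstance,
        ofOperator_orthogonal_one_two T ▸ inferInstance⟩
    · exact ⟨ofOperator_inf_one_three T ▸ inferInstance,
        ofOperator_orthogonal_one_three T ▸ inferInstance⟩
    · exact ⟨finiteDimensional_of_eq_map (ofOperator_inf_two_three T),
        finiteDimensional_of_eq_map (ofOperator_orthogonal_two_three T)⟩
  intro i j hij
  rcases lt_or_gt_of_ne hij with h | h
  · exact key i j h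
  · rw [inf_comm, sup_comm]
    exact key j i h

/-- The sum over pairs is expanded for an abstract system, so that the special form of `ofOperator`
plays no part in the bookkeeping. -/
theorem defect_eq_of_finrank (𝒮 : SubspaceSystem.{u} 4)
    {d₀₁ c₀₁ d₀₂ c₀₂ d₀₃ c₀₃ d₁₂ c₁₂ d₁₃ c₁₃ d₂₃ c₂₃ : ℕ}
    (h₀₁ : Module.finrank ℂ ↥(𝒮.E 0 ⊓ 𝒮.E 1) = d₀₁)
    (k₀₁ : Module.finrank ℂ ↥(𝒮.E 0 ⊔ 𝒮.E 1)ᗮ = c₀₁)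
    (h₀₂ : Module.finrank ℂ ↥(𝒮.E 0 ⊓ 𝒮.E 2) = d₀₂)
    (k₀₂ : Module.finrank ℂ ↥(𝒮.E 0 ⊔ 𝒮.E 2)ᗮ = c₀₂)
    (h₀₃ : Module.finrank ℂ ↥(𝒮.E 0 ⊓ 𝒮.E 3) = d₀₃)
    (k₀₃ : Module.finrank ℂ ↥(𝒮.E 0 ⊔ 𝒮.E 3)ᗮ = c₀₃)
    (h₁₂ : Module.finrank ℂ ↥(𝒮.E 1 ⊓ 𝒮.E 2) = d₁₂)
    (k₁₂ : Module.finrank ℂ ↥(𝒮.E 1 ⊔ 𝒮.E 2)ᗮ = c₁₂)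
    (h₁₃ : Module.finrank ℂ ↥(𝒮.E 1 ⊓ 𝒮.E 3) = d₁₃)
    (k₁₃ : Module.finrank ℂ ↥(𝒮.E 1 ⊔ 𝒮.E 3)ᗮ = c₁₃)
    (h₂₃ : Module.finrank ℂ ↥(𝒮.E 2 ⊓ 𝒮.E 3) = d₂₃)
    (k₂₃ : Module.finrank ℂ ↥(𝒮.E 2 ⊔ 𝒮.E 3)ᗮ = c₂₃) :
    𝒮.defect = (1 / 3) * (((d₀₁ : ℚ) - c₀₁) + ((d₀₂ : ℚ) - c₀₂) + ((d₀₃ : ℚ) - c₀₃) +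
      ((d₁₂ : ℚ) - c₁₂) + ((d₁₃ : ℚ) - c₁₃) + ((d₂₃ : ℚ) - c₂₃)) := by
  have hset : (Finset.univ.filter fun p : Fin 4 × Fin 4 => p.1 < p.2) =
      {(0, 1), (0, 2), (0, 3), (1, 2), (1, 3), (2, 3)} := by decide
  unfold defect
  rw [hset, Finset.sum_insert (by decide), Finset.sum_insert (by decide),
    Finset.sum_insert (by decide), Finset.sum_insert (by decide), Finset.sum_insert (by decide),
    Finset.sum_singleton, h₀₁, k₀₁, h₀₂, k₀₂, h₀₃, k₀₃, h₁₂, k₁₂, h₁₃, k₁₃, h₂₃, k₂₃]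
  ring

theorem defect_ofOperator :
    (ofOperator T).defect = (1 / 3) *
      ((Module.finrank ℂ (LinearMap.ker (T : K →ₗ[ℂ] K)) : ℚ) -
        Module.finrank ℂ (LinearMap.ker (T.adjoint : K →ₗ[ℂ] K)) +
        (Module.finrank ℂ (LinearMap.ker ((T - 1 : K →L[ℂ] K) : K →ₗ[ℂ] K)) -
        Module.finrank ℂ (LinearMap.ker ((T.adjoint - 1 : K →L[ℂ] K) : K →ₗ[ℂ] K)))) := by
  have f₁ := finrank_of_eq_map (lineEmbedding_injective (by simp)) (ofOperator_inf_zero_two T)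
  have f₂ := finrank_of_eq_map (lineEmbedding_injective (by simp))
    (ofOperator_orthogonal_zero_two T)
  have f₃ := finrank_of_eq_map (lineEmbedding_injective (by simp)) (ofOperator_inf_two_three T)
  have f₄ := finrank_of_eq_map (lineEmbedding_injective (by simp))
    (ofOperator_orthogonal_two_three T)
  have hbot {p : Submodule ℂ (ofOperator T).H} (h : p = ⊥) : Module.finrank ℂ p = 0 :=
    h ▸ finrank_bot ℂ _
  refine (defect_eq_of_finrank (ofOperator T)
    (hbot (ofOperator_inf_zero_one T)) (hbot (ofOperator_orthogonal_zero_one T)) f₁ f₂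
    (hbot (ofOperator_inf_zero_three T)) (hbot (ofOperator_orthogonal_zero_three T))
    (hbot (ofOperator_inf_one_two T)) (hbot (ofOperator_orthogonal_one_two T))
    (hbot (ofOperator_inf_one_three T)) (hbot (ofOperator_orthogonal_one_three T))
    f₃ f₄).trans ?_
  push_cast
  ring

end Defect

end SubspaceSystem

/-! ### The unilateral shift: eigenvectors and commutant -/

section Shift

open ContinuousLinearMap

theorem EllTwo.add_apply (x y : EllTwo) (k : ℕ) : (x + y) k = x k + y k := rfl

theorem EllTwo.sub_apply (x y : EllTwo) (k : ℕ) : (x - y) k = x k - y k := rfl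

theorem EllTwo.smul_apply (c : ℂ) (x : EllTwo) (k : ℕ) : (c • x) k = c * x k := rfl

theorem EllTwo.zero_apply (k : ℕ) : (0 : EllTwo) k = 0 := rfl

theorem unilateralShift_apply_zero (x : EllTwo) : unilateralShift x 0 = 0 := rfl

theorem unilateralShift_apply_succ (x : EllTwo) (k : ℕ) : unilateralShift x (k + 1) = x k := rfl

theorem norm_unilateralShift (x : EllTwo) : ‖unilateralShift x‖ = ‖x‖ := by
  refine Real.rpow_left_injOn (x := (2 : ENNReal).toReal) (by norm_num)
    (norm_nonneg _) (norm_nonneg _) ?_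
  exact (lp.hasSum_norm (p := 2) (by norm_num) _).unique (hasSum_shiftSeq x)

theorem unilateralShift_single (k : ℕ) :
    unilateralShift (lp.single 2 k (1 : ℂ)) = lp.single 2 (k + 1) (1 : ℂ) := by
  ext j
  cases j with
  | zero => simp [unilateralShift_apply_zero, lp.single_apply]
  | succ j => simp [unilateralShift_apply_succ, lp.single_apply, Pi.single_apply]

theorem adjoint_unilateralShift_apply (x : EllTwo) (k : ℕ) :
    adjoint unilateralShift x k = x (k + 1) := by
  have h := adjoint_inner_right unilateralShift (lp.single 2 k (1 : ℂ)) x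
  rw [unilateralShift_single, lp.inner_single_left, lp.inner_single_left] at h
  simpa using h

theorem norm_unilateralShift_le : ‖unilateralShift‖ ≤ 1 :=
  opNorm_le_bound _ zero_le_one fun x => by rw [norm_unilateralShift, one_mul]

theorem eq_zero_of_unilateralShift_eq_smul {b : ℂ} (hb : b ≠ 0) {x : EllTwo}
    (h : unilateralShift x = b • x) : x = 0 := by
  have hk (k : ℕ) : unilateralShift x k = b * x k := by rw [h]; rfl
  ext k
  change x k = 0
  induction k with
  | zero => simpa [unilateralShift_apply_zero, hb, eq_comm] using hk 0
  | succ k ih => simpa [unilateralShift_apply_succ, hb, ih, eq_comm] using hk (k + 1)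

theorem eq_zero_of_adjoint_unilateralShift_eq_smul {b : ℂ} (hb : 1 < ‖b‖) {x : EllTwo}
    (h : adjoint unilateralShift x = b • x) : x = 0 := by
  have h1 : ‖adjoint unilateralShift x‖ ≤ 1 * ‖x‖ :=
    le_of_opNorm_le _ (by rw [LinearIsometryEquiv.norm_map]; exact norm_unilateralShift_le) x
  rw [h, norm_smul] at h1
  by_contra hx
  have := norm_pos_iff.2 hx
  nlinarith

/-- For `|a| < 1`, the equation `S* y = a y - z` is solvable with a prescribed first coordinate
of `y`. -/
theorem exists_adjoint_unilateralShift_eq {a : ℂ} (ha : ‖a‖ < 1) (z : EllTwo) (c : ℂ) :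
    ∃ y : EllTwo, adjoint unilateralShift y = a • y - z ∧ y 0 = c := by
  -- Applying `S` to `S* y = a y - z` and using `S S* y = y - y₀ e₀` gives `(1 - a S) y = c e₀ - S
  -- z`, which is solved by a Neumann series.
  have hn : ‖a • unilateralShift‖ < 1 := by
    rw [norm_smul]
    exact (mul_le_of_le_one_right (norm_nonneg a) norm_unilateralShift_le).trans_lt ha
  obtain ⟨u, hu⟩ := isUnit_one_sub_of_norm_lt_one hn
  set w : EllTwo := lp.single 2 0 c - unilateralShift z
  let y : EllTwo := (↑u⁻¹ : EllTwo →L[ℂ] EllTwo) w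
  have hy : y - a • unilateralShift y = w := by
    have : (1 - a • unilateralShift) * (↑u⁻¹ : EllTwo →L[ℂ] EllTwo) = 1 := by
      rw [← hu, Units.mul_inv]
    exact congrArg (fun f : EllTwo →L[ℂ] EllTwo => f w) this
  have hyk (k : ℕ) : y k = a * unilateralShift y k + w k := by
    have := congrArg (fun f : EllTwo => f k) hy
    have : y k - a * unilateralShift y k = w k := this
    linear_combination this
  have hwk (k : ℕ) : w k = (lp.single 2 0 c : EllTwo) k - unilateralShift z k := rfl
  refine ⟨y, ?_, ?_⟩
  · ext k
    rw [adjoint_unilateralShift_apply, hyk, hwk, unilateralShift_apply_succ,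
      unilateralShift_apply_succ]
    rw [EllTwo.sub_apply, EllTwo.smul_apply]
    simp [sub_eq_add_neg]
  · rw [hyk, hwk, unilateralShift_apply_zero, unilateralShift_apply_zero]
    simp

/-- The power series with the coordinates of `x` as coefficients. -/
noncomputable def toPowerSeries (x : EllTwo) : PowerSeries ℂ := PowerSeries.mk x

theorem toPowerSeries_injective : Function.Injective toPowerSeries := fun x y h => by
  ext k
  simpa [toPowerSeries] using congrArg (PowerSeries.coeff k) h

theorem eq_smul_single_add_unilateralShift (x : EllTwo) :
    x = x 0 • lp.single 2 0 1 + unilateralShift (adjoint unilateralShift x) := by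
  ext j
  rw [EllTwo.add_apply, EllTwo.smul_apply]
  cases j with
  | zero => simp [unilateralShift_apply_zero]
  | succ j => simp [unilateralShift_apply_succ, adjoint_unilateralShift_apply]

theorem toPowerSeries_eq_add (x : EllTwo) :
    toPowerSeries x = PowerSeries.C (x 0) +
      PowerSeries.X * toPowerSeries (adjoint unilateralShift x) := by
  ext j
  cases j with
  | zero => simp [toPowerSeries]
  | succ j => simp [toPowerSeries, adjoint_unilateralShift_apply, PowerSeries.coeff_succ_X_mul]

/-- An operator that commutes with the shift is the multiplication by a power series. -/
theorem toPowerSeries_apply_of_commute {A : EllTwo →L[ℂ] EllTwo}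
    (hA : Commute A unilateralShift) (x : EllTwo) :
    toPowerSeries (A x) = toPowerSeries x * toPowerSeries (A (lp.single 2 0 1)) := by
  set f := A (lp.single 2 0 1)
  -- Apply `A` to `x = x₀ e₀ + S S* x` and move it past `S`.
  have hAx (x : EllTwo) (k : ℕ) :
      A x k = x 0 * f k + unilateralShift (A (adjoint unilateralShift x)) k := by
    have h : A (unilateralShift (adjoint unilateralShift x)) =
      unilateralShift (A (adjoint unilateralShift x)) :=
      congrArg (fun g : EllTwo →L[ℂ] EllTwo => g _) hA.eq
    conv_lhs => rw [eq_smul_single_add_unilateralShift x]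
    rw [map_add, map_smul, h]
    rfl
  have hcoeff (y : EllTwo) (k : ℕ) : PowerSeries.coeff k (toPowerSeries y) = y k :=
    PowerSeries.coeff_mk _ _
  ext k
  rw [hcoeff, hAx, toPowerSeries_eq_add x, add_mul, map_add, PowerSeries.coeff_C_mul, hcoeff,
    mul_assoc]
  -- The coefficient of index `k + 1` for `x` is reduced to the one of index `k` for `S* x`, so `x`
  -- has to vary.
  induction k generalizing x with
  | zero => rw [PowerSeries.coeff_zero_X_mul, unilateralShift_apply_zero]
  | succ k ih =>
    rw [PowerSeries.coeff_succ_X_mul, unilateralShift_apply_succ, hAx (adjoint unilateralShift x), ih,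
      toPowerSeries_eq_add (adjoint unilateralShift x), add_mul, map_add,
      PowerSeries.coeff_C_mul, hcoeff, mul_assoc]

/-- The unilateral shift is strongly irreducible. -/
theorem eq_zero_or_one_of_commute_unilateralShift (A : EllTwo →L[ℂ] EllTwo) (hA : A * A = A)
    (hc : Commute A unilateralShift) : A = 0 ∨ A = 1 := by
  set f := toPowerSeries (A (lp.single 2 0 1))
  have h1 (x : EllTwo) : toPowerSeries (A x) = toPowerSeries x * f :=
    toPowerSeries_apply_of_commute hc x
  have hf : f * f = f := by
    rw [← h1]
    exact congrArg (fun g : EllTwo →L[ℂ] EllTwo => toPowerSeries (g (lp.single 2 0 1))) hA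
  have h0 : toPowerSeries 0 = 0 := by ext k; exact PowerSeries.coeff_mk _ _
  -- The symbol `f` is an idempotent of `ℂ⟦X⟧`, which has no zero divisors.
  rcases mul_eq_zero.1 (show f * (f - 1) = 0 by rw [mul_sub, hf, mul_one, sub_self]) with h | h
  · left
    ext1 x
    apply toPowerSeries_injective
    rw [h1, h, mul_zero]
    exact h0.symm
  · right
    ext1 x
    apply toPowerSeries_injective
    rw [h1, sub_eq_zero.1 h, mul_one]
    rfl

end Shift

/-! ### Commutants of an isometry plus a commuting nilpotent -/

section Commutator

open ContinuousLinearMap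

variable {K : Type*} [NormedAddCommGroup K] [NormedSpace ℂ K]

/-- The Leibniz rule for the derivation `[·, X]`: when `[D, X]` commutes with `D`, powers
differentiate as in the commutative case. -/
theorem pow_mul_sub_mul_pow_of_commute {R : Type*} [Ring R] {D X : R}
    (h : Commute D (D * X - X * D)) (k : ℕ) :
    D ^ (k + 1) * X - X * D ^ (k + 1) = (k + 1 : ℕ) • (D ^ k * (D * X - X * D)) := by
  induction k with
  | zero => simp
  | succ k ih =>
    have h2 : D ^ (k + 1 + 1) * X - X * D ^ (k + 1 + 1) =
        D * (D ^ (k + 1) * X - X * D ^ (k + 1)) + (D * X - X * D) * D ^ (k + 1) := by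
      rw [pow_succ' D (k + 1)]; noncomm_ring
    rw [h2, ih, ← (h.pow_left (k + 1)).eq, mul_smul_comm, ← mul_assoc, ← pow_succ',
      succ_nsmul _ (k + 1)]

/-- A commutator `DX - XD` with an isometry `D` vanishes if it commutes with `D`. -/
theorem commutator_eq_zero_of_commute {D X : K →L[ℂ] K} (hD : ∀ x, ‖D x‖ = ‖x‖)
    (h : Commute D (D * X - X * D)) : D * X - X * D = 0 := by
  set Y := D * X - X * D
  have hpow (k : ℕ) (x : K) : ‖(D ^ k) x‖ = ‖x‖ := by
    induction k generalizing x with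
    | zero => simp
    | succ k ih => 
      rw [pow_succ]
      exact (ih (D x)).trans (hD x)
  ext1 x
  rw [zero_apply]
  by_contra hx
  have hpos := norm_pos_iff.2 hx
  -- As `D ^ k` is isometric, the power rule evaluated at `x` has norm `(k + 1) ‖Y x‖` on one side
  -- and at most `2 ‖X‖ ‖x‖` on the other.
  obtain ⟨k, hk⟩ := exists_nat_gt ((2 * ‖X‖ * ‖x‖) / ‖Y x‖)
  rw [div_lt_iff₀ hpos] at hk
  have h1 := congrArg (fun f : K →L[ℂ] K => f x) (pow_mul_sub_mul_pow_of_commute h k)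
  have h2 : (D ^ (k + 1)) (X x) - X ((D ^ (k + 1)) x) = (k + 1 : ℕ) • (D ^ k) (Y x) := h1
  have h3 : ‖(D ^ (k + 1)) (X x) - X ((D ^ (k + 1)) x)‖ ≤ 2 * ‖X‖ * ‖x‖ := by
    refine (norm_sub_le _ _).trans ?_
    have h4 := X.le_opNorm ((D ^ (k + 1)) x)
    have h5 := X.le_opNorm x
    rw [hpow] at h4 ⊢
    linarith
  rw [h2, ← Nat.cast_smul_eq_nsmul ℝ, norm_smul, hpow, Real.norm_natCast] at h3
  push_cast at h3
  nlinarith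

/-- If `D` is an isometry and `N` is a nilpotent operator commuting with `D`, then every operator
commuting with `D + N` commutes with `D`. -/
theorem commute_isometry_of_commute_add {D N A : K →L[ℂ] K} (hD : ∀ x, ‖D x‖ = ‖x‖)
    (hN : IsNilpotent N) (hDN : Commute D N) (hA : Commute A (D + N)) : Commute A D := by
  -- `d = [D, ·]` and `e = [N, ·]` commute, `e` is nilpotent along with `N`, and `d A = -e A`. Hence
  -- `d ^ k A = ± e ^ k A`, which vanishes for large `k`.
  set d := LinearMap.mulLeft ℂ D - LinearMap.mulRight ℂ D with hd
  set e := LinearMap.mulLeft ℂ N - LinearMap.mulRight ℂ N with he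
  obtain ⟨m, hm⟩ : IsNilpotent e :=
    (LinearMap.commute_mulLeft_right (R := ℂ) N N).isNilpotent_sub
      ((LinearMap.isNilpotent_mulLeft_iff ℂ N).2 hN) ((LinearMap.isNilpotent_mulRight_iff ℂ N).2 hN)
  have hdX (X) : d X = D * X - X * D := rfl
  have heX (X) : e X = N * X - X * N := rfl
  have hde : Commute d e := by
    refine LinearMap.ext fun X => ?_
    change d (e X) = e (d X)
    simp only [hdX, heX, mul_sub, sub_mul, ← mul_assoc, hDN.eq]
    simp only [mul_assoc, hDN.eq]
    abel
  have hdA : d A = -e A := by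
    have := hA.eq
    rw [mul_add, add_mul] at this
    rw [hdX, heX, neg_sub, sub_eq_sub_iff_add_eq_add, ← this]
    abel
  have hpow (k : ℕ) : (d ^ k) A = (-1 : ℂ) ^ k • (e ^ k) A := by
    induction k with
    | zero => simp
    | succ k ih =>
      rw [pow_succ', Module.End.mul_apply, ih, map_smul, ← Module.End.mul_apply,
        (hde.pow_right k).eq, Module.End.mul_apply, hdA, map_neg, ← Module.End.mul_apply,
        ← pow_succ, pow_succ (-1 : ℂ), mul_neg_one, smul_neg, neg_smul]
  -- Descent: `d (d X) = 0` says that `[D, X]` commutes with `D`, so `d X = 0` by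
  -- `commutator_eq_zero_of_commute`.
  have hzero (k : ℕ) (h : (d ^ (k + 1)) A = 0) : d A = 0 := by
    induction k with
    | zero => simpa using h
    | succ k ih =>
      apply ih
      rw [pow_succ', Module.End.mul_apply, pow_succ', Module.End.mul_apply] at h
      rw [pow_succ', Module.End.mul_apply, hdX]
      refine commutator_eq_zero_of_commute hD ?_
      rw [← hdX]
      rw [hdX (d _)] at h
      exact sub_eq_zero.1 h
  have h := hzero m (by rw [hpow, pow_succ e, hm]; simp)
  rw [hdX] at h
  exact (sub_eq_zero.1 h).symm

end Commutator

/-! ### The block operator `V`: strong irreducibility and eigenspaces -/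

section BlockOperators

open ContinuousLinearMap

variable {n : ℕ}

theorem blockOperator_apply (A : Matrix (Fin n) (Fin n) (EllTwo →L[ℂ] EllTwo))
    (x : EllTwoPow n) (i : Fin n) : blockOperator A x i = ∑ j, A i j (x j) := by
  simp [blockOperator]

theorem adjoint_blockOperator_apply (A : Matrix (Fin n) (Fin n) (EllTwo →L[ℂ] EllTwo))
    (x : EllTwoPow n) (i : Fin n) :
    adjoint (blockOperator A) x i = ∑ j, adjoint (A j i) (x j) := by
  let B : Matrix (Fin n) (Fin n) (EllTwo →L[ℂ] EllTwo) := Matrix.of fun i j => adjoint (A j i)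
  have hB (i j) : B i j = adjoint (A j i) := rfl
  have h : blockOperator B = adjoint (blockOperator A) := by
    refine (eq_adjoint_iff _ _).2 fun x y => ?_
    rw [PiLp.inner_apply, PiLp.inner_apply]
    simp_rw [blockOperator_apply, sum_inner, inner_sum, hB, adjoint_inner_left]
    exact Finset.sum_comm
  rw [← h, blockOperator_apply]
  rfl

/-- The operator `S ⊗ I`. -/
noncomputable def diagonalShift (n : ℕ) : EllTwoPow n →L[ℂ] EllTwoPow n :=
  blockOperator fun i j => if i = j then unilateralShift else 0

/-- The operator with identities on the first subdiagonal. -/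
noncomputable def subdiagonal (n : ℕ) : EllTwoPow n →L[ℂ] EllTwoPow n :=
  blockOperator fun i j =>
    if (i : ℕ) = (j : ℕ) + 1 then ContinuousLinearMap.id ℂ EllTwo else 0

theorem diagonalShift_apply (x : EllTwoPow n) (i : Fin n) :
    diagonalShift n x i = unilateralShift (x i) := by
  refine (blockOperator_apply _ x i).trans ?_
  rw [Finset.sum_eq_single i]
  · simp
  · intro j _ hj
    simp [hj.symm]
  · simp

theorem subdiagonal_apply_zero (x : EllTwoPow n) (i : Fin n) (hi : (i : ℕ) = 0) :
    subdiagonal n x i = 0 := by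
  refine (blockOperator_apply _ x i).trans ?_
  refine Finset.sum_eq_zero fun j _ => ?_
  rw [if_neg (by omega)]
  rfl

theorem subdiagonal_apply_succ (x : EllTwoPow n) (i j : Fin n) (hij : (i : ℕ) = j + 1) :
    subdiagonal n x i = x j := by
  refine (blockOperator_apply _ x i).trans ?_
  rw [Finset.sum_eq_single j]
  · simp [hij]
  · intro k _ hk
    rw [if_neg (fun h => hk (Fin.ext (by omega)))]
    rfl
  · simp

theorem blockShift_eq : blockShift n = diagonalShift n + subdiagonal n := by
  ext1 x
  refine PiLp.ext fun i => ?_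
  change blockShift n x i = diagonalShift n x i + subdiagonal n x i
  refine (blockOperator_apply _ x i).trans (Eq.trans ?_ (congrArg₂ (· + ·)
    (blockOperator_apply _ x i) (blockOperator_apply _ x i)).symm)
  rw [← Finset.sum_add_distrib]
  refine Finset.sum_congr rfl fun j _ => ?_
  by_cases h : i = j
  · subst h
    simp
  · simp [h]

theorem blockShift_apply (x : EllTwoPow n) (i : Fin n) :
    blockShift n x i = unilateralShift (x i) + subdiagonal n x i := by
  rw [← diagonalShift_apply, blockShift_eq]
  rfl

theorem adjoint_blockShift_apply_last (x : EllTwoPow n) (i : Fin n) (hi : (i : ℕ) + 1 = n) :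
    adjoint (blockShift n) x i = adjoint unilateralShift (x i) := by
  refine (adjoint_blockOperator_apply _ x i).trans ?_
  rw [Finset.sum_eq_single i]
  · simp
  · intro j _ hj
    rw [if_neg hj, if_neg (by omega), map_zero]
    rfl
  · simp

theorem adjoint_blockShift_apply_of_succ (x : EllTwoPow n) (i j : Fin n) (hij : (j : ℕ) = i + 1) :
    adjoint (blockShift n) x i = adjoint unilateralShift (x i) + x j := by
  have hne : i ≠ j := fun h => by subst h; omega
  refine (adjoint_blockOperator_apply _ x i).trans ?_
  rw [Finset.sum_eq_add i j hne]
  · rw [if_pos rfl, if_neg hne.symm, if_pos hij]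
    congr 1
    rw [adjoint_id]
    rfl
  · intro k _ hk
    rw [if_neg hk.1, if_neg (fun h => hk.2 (Fin.ext (by omega))), map_zero]
    rfl
  · simp
  · simp

theorem norm_diagonalShift (x : EllTwoPow n) : ‖diagonalShift n x‖ = ‖x‖ := by
  refine (sq_eq_sq₀ (norm_nonneg _) (norm_nonneg _)).1 ?_
  rw [PiLp.norm_sq_eq_of_L2, PiLp.norm_sq_eq_of_L2]
  simp_rw [diagonalShift_apply, norm_unilateralShift]

theorem commute_diagonalShift_subdiagonal : Commute (diagonalShift n) (subdiagonal n) := by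
  refine ContinuousLinearMap.ext fun x => PiLp.ext fun i => ?_
  change diagonalShift n (subdiagonal n x) i = subdiagonal n (diagonalShift n x) i
  rcases Nat.eq_zero_or_pos (i : ℕ) with hi | hi
  · rw [diagonalShift_apply, subdiagonal_apply_zero _ i hi, subdiagonal_apply_zero _ i hi,
      map_zero]
  · have h : (i : ℕ) = (⟨i - 1, by omega⟩ : Fin n) + 1 := by simp; omega
    rw [diagonalShift_apply, subdiagonal_apply_succ _ i _ h, subdiagonal_apply_succ _ i _ h,
      diagonalShift_apply]

theorem subdiagonal_pow_apply (k : ℕ) (x : EllTwoPow n) (i : Fin n) (hi : (i : ℕ) < k) :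
    (subdiagonal n ^ k) x i = 0 := by
  induction k generalizing i with
  | zero => omega
  | succ k ih =>
    rw [pow_succ']
    change subdiagonal n ((subdiagonal n ^ k) x) i = 0
    rcases Nat.eq_zero_or_pos (i : ℕ) with h0 | h0
    · exact subdiagonal_apply_zero _ i h0
    · have h : (i : ℕ) = (⟨i - 1, by omega⟩ : Fin n) + 1 := by simp; omega
      rw [subdiagonal_apply_succ _ i _ h]
      exact ih _ (by simp; omega)

theorem subdiagonal_pow_self : subdiagonal n ^ n = 0 := by
  refine ContinuousLinearMap.ext fun x => PiLp.ext fun i => ?_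
  exact subdiagonal_pow_apply n x i i.2

theorem apply_eq_zero_of_subdiagonal_eq_zero {x : EllTwoPow n} (hx : subdiagonal n x = 0)
    (i : Fin n) (hi : (i : ℕ) + 1 < n) : x i = 0 := by
  rw [← subdiagonal_apply_succ x ⟨i + 1, hi⟩ i rfl, hx]
  rfl

/-- The embedding of `ℓ²` as the last summand. -/
noncomputable def lastEmbedding (m : ℕ) : EllTwo →L[ℂ] EllTwoPow (m + 1) :=
  (PiLp.continuousLinearEquiv 2 ℂ (fun _ : Fin (m + 1) => EllTwo)).symm.toContinuousLinearMap ∘L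
    ContinuousLinearMap.single ℂ (fun _ : Fin (m + 1) => EllTwo) (Fin.last m)

theorem lastEmbedding_apply_last (m : ℕ) (x : EllTwo) :
    lastEmbedding m x (Fin.last m) = x := by
  simp [lastEmbedding]

theorem lastEmbedding_apply_of_ne (m : ℕ) (x : EllTwo) (i : Fin (m + 1)) (hi : i ≠ Fin.last m) :
    lastEmbedding m x i = 0 := by
  simp [lastEmbedding, hi]

theorem subdiagonal_lastEmbedding (m : ℕ) (x : EllTwo) :
    subdiagonal (m + 1) (lastEmbedding m x) = 0 := by
  refine PiLp.ext fun i => ?_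
  rcases Nat.eq_zero_or_pos (i : ℕ) with h0 | h0
  · exact subdiagonal_apply_zero _ i h0
  · have h : (i : ℕ) = (⟨i - 1, by omega⟩ : Fin (m + 1)) + 1 := by simp; omega
    rw [subdiagonal_apply_succ _ i _ h]
    exact lastEmbedding_apply_of_ne _ _ _ (fun h => by
      have := congrArg Fin.val h
      simp at this
      omega)

/-- The subdiagonal operator moves block `i` to block `i + 1` and loses only the last one, so its
kernel is the last summand. -/
theorem eq_lastEmbedding (m : ℕ) {x : EllTwoPow (m + 1)} (hx : subdiagonal (m + 1) x = 0) :
    x = lastEmbedding m (x (Fin.last m)) := by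
  refine PiLp.ext fun i => ?_
  by_cases hi : i = Fin.last m
  · rw [hi, lastEmbedding_apply_last]
  · rw [lastEmbedding_apply_of_ne _ _ _ hi]
    exact apply_eq_zero_of_subdiagonal_eq_zero hx i (by
      have := Fin.val_lt_last hi
      omega)

/-- An idempotent commuting with a nilpotent operator vanishes if it vanishes on the kernel of
the nilpotent operator. -/
theorem eq_zero_of_idempotent_of_ker {K : Type*} [NormedAddCommGroup K] [NormedSpace ℂ K]
    {A N : K →L[ℂ] K} (hA : A * A = A) (hAN : Commute A N) (hN : IsNilpotent N)
    (h : ∀ x, N x = 0 → A x = 0) : A = 0 := by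
  obtain ⟨n, hn⟩ := hN
  -- Induction along the kernels of `N ^ k`: since `N (A x) = A (N x) = 0`, the vector `A x` lies in
  -- `ker N`, and then `A x = A (A x) = 0`.
  have hk (k : ℕ) (x : K) (hx : (N ^ k) x = 0) : A x = 0 := by
    induction k generalizing x with
    | zero =>
      have : x = 0 := hx
      rw [this, map_zero]
    | succ k ih =>
      have h1 : A (N x) = 0 := ih (N x) (by rw [pow_succ] at hx; exact hx)
      have h2 : N (A x) = 0 := by
        rw [← h1]
        exact congrArg (fun f : K →L[ℂ] K => f x) hAN.eq.symm
      have h3 : A (A x) = A x := congrArg (fun f : K →L[ℂ] K => f x) hA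
      rw [← h3]
      exact h _ h2
  ext1 x
  exact hk n x (by rw [hn]; rfl)

/-- The operator `V` is strongly irreducible. -/
theorem eq_zero_or_one_of_commute_blockShift (hn : 0 < n) (A : EllTwoPow n →L[ℂ] EllTwoPow n)
    (hA : A * A = A) (hc : Commute A (blockShift n)) : A = 0 ∨ A = 1 := by
  obtain ⟨m, rfl⟩ := Nat.exists_eq_add_one_of_ne_zero hn.ne'
  have hnil : IsNilpotent (subdiagonal (m + 1)) := ⟨m + 1, subdiagonal_pow_self⟩
  rw [blockShift_eq] at hc
  have hAD : Commute A (diagonalShift (m + 1)) :=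
    commute_isometry_of_commute_add norm_diagonalShift hnil commute_diagonalShift_subdiagonal hc
  have hAN : Commute A (subdiagonal (m + 1)) := by
    have := hc.sub_right hAD
    rwa [add_sub_cancel_left] at this
  -- The restriction of `A` to `ker N`, which `A` preserves, read on the last copy of `ℓ²`; there `S
  -- ⊗ I` acts as `S`.
  let B : EllTwo →L[ℂ] EllTwo :=
    PiLp.proj (𝕜 := ℂ) 2 (fun _ : Fin (m + 1) => EllTwo) (Fin.last m) ∘L A ∘L lastEmbedding m
  have hB (x : EllTwo) : A (lastEmbedding m x) = lastEmbedding m (B x) := by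
    refine eq_lastEmbedding m ?_
    have h : subdiagonal (m + 1) (A (lastEmbedding m x)) =
        A (subdiagonal (m + 1) (lastEmbedding m x)) :=
      congrArg (fun f : EllTwoPow (m + 1) →L[ℂ] EllTwoPow (m + 1) => f _) hAN.eq.symm
    rw [h, subdiagonal_lastEmbedding, map_zero]
  have hinj : Function.Injective (lastEmbedding m) := fun x y h => by
    rw [← lastEmbedding_apply_last m x, h, lastEmbedding_apply_last]
  have hBB : B * B = B := by
    ext1 x
    apply hinj
    change lastEmbedding m (B (B x)) = _
    rw [← hB, ← hB]
    exact congrArg (fun f : EllTwoPow (m + 1) →L[ℂ] EllTwoPow (m + 1) => f _) hA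
  have hDlast (x : EllTwo) :
      diagonalShift (m + 1) (lastEmbedding m x) = lastEmbedding m (unilateralShift x) := by
    refine PiLp.ext fun i => ?_
    rw [diagonalShift_apply]
    by_cases hi : i = Fin.last m
    · rw [hi, lastEmbedding_apply_last, lastEmbedding_apply_last]
    · rw [lastEmbedding_apply_of_ne _ _ _ hi, lastEmbedding_apply_of_ne _ _ _ hi, map_zero]
  have hBS : Commute B unilateralShift := by
    refine ContinuousLinearMap.ext fun x => hinj ?_
    change lastEmbedding m (B (unilateralShift x)) = lastEmbedding m (unilateralShift (B x))
    rw [← hB, ← hDlast, ← hDlast, ← hB]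
    exact congrArg (fun f : EllTwoPow (m + 1) →L[ℂ] EllTwoPow (m + 1) => f _) hAD.eq
  rcases eq_zero_or_one_of_commute_unilateralShift B hBB hBS with h | h
  · left
    refine eq_zero_of_idempotent_of_ker hA hAN hnil fun x hx => ?_
    rw [eq_lastEmbedding m hx, hB, h, zero_apply, map_zero]
  · right
    -- The complementary idempotent `1 - A` vanishes on `ker N`.
    refine (sub_eq_zero.1 (eq_zero_of_idempotent_of_ker (A := 1 - A) ?_
      ((Commute.one_left _).sub_left hAN) hnil fun x hx => ?_)).symm
    · rw [mul_sub, sub_mul, sub_mul, hA]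
      simp
    · change x - A x = 0
      conv_lhs => rw [eq_lastEmbedding m hx, hB, h]
      exact sub_self _

/-- `V` is lower triangular: solving from block `0` onwards, every row becomes the eigenvalue
equation of `S`. -/
theorem eq_zero_of_blockShift_eq_smul {b : ℂ} (hb : b ≠ 0) {x : EllTwoPow n}
    (h : blockShift n x = b • x) : x = 0 := by
  have hi (i : Fin n) : unilateralShift (x i) + subdiagonal n x i = b • x i := by
    rw [← blockShift_apply, h]
    rfl
  have key (k : ℕ) (hk : k < n) : x ⟨k, hk⟩ = 0 := by
    induction k with
    | zero =>
      refine eq_zero_of_unilateralShift_eq_smul hb ?_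
      rw [← hi, subdiagonal_apply_zero _ _ rfl, add_zero]
    | succ k ih =>
      refine eq_zero_of_unilateralShift_eq_smul hb ?_
      rw [← hi, subdiagonal_apply_succ _ _ ⟨k, by omega⟩ rfl, ih, add_zero]
  exact PiLp.ext fun i => key i i.2

/-- `V*` is upper triangular, so the rows are solved from the last block backwards, each reducing to
the equation for the contraction `S*`. -/
theorem eq_zero_of_adjoint_blockShift_eq_smul {b : ℂ} (hb : 1 < ‖b‖) {x : EllTwoPow n}
    (h : adjoint (blockShift n) x = b • x) : x = 0 := by
  have hi (i : Fin n) : adjoint (blockShift n) x i = b • x i := by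
    rw [h]
    rfl
  have key (k : ℕ) (i : Fin n) (hk : (i : ℕ) + 1 + k = n) : x i = 0 := by
    induction k generalizing i with
    | zero =>
      refine eq_zero_of_adjoint_unilateralShift_eq_smul hb ?_
      rw [← hi, adjoint_blockShift_apply_last _ _ hk]
    | succ k ih =>
      refine eq_zero_of_adjoint_unilateralShift_eq_smul hb ?_
      rw [← hi, adjoint_blockShift_apply_of_succ _ i ⟨i + 1, by omega⟩ rfl,
        ih ⟨i + 1, by omega⟩ (by simp; omega), add_zero]
  exact PiLp.ext fun i => key (n - (i + 1)) i (by omega)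

/-- The map `x ↦ (x_i(0))_i` on the eigenspace of `V*`. -/
noncomputable def eigenspaceEval (n : ℕ) (a : ℂ) :
    LinearMap.ker ((adjoint (blockShift n) - a • 1 : EllTwoPow n →L[ℂ] EllTwoPow n) :
      EllTwoPow n →ₗ[ℂ] EllTwoPow n) →ₗ[ℂ] (Fin n → ℂ) where
  toFun x i := x.1 i 0
  map_add' _ _ := rfl
  map_smul' _ _ := rfl

theorem mem_ker_adjoint_blockShift_iff (a : ℂ) (x : EllTwoPow n) :
    x ∈ LinearMap.ker ((adjoint (blockShift n) - a • 1 : EllTwoPow n →L[ℂ] EllTwoPow n) :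
      EllTwoPow n →ₗ[ℂ] EllTwoPow n) ↔ ∀ i, adjoint (blockShift n) x i = a • x i := by
  have h : x ∈ LinearMap.ker ((adjoint (blockShift n) - a • 1 :
      EllTwoPow n →L[ℂ] EllTwoPow n) : EllTwoPow n →ₗ[ℂ] EllTwoPow n) ↔
      adjoint (blockShift n) x - a • x = 0 := Iff.rfl
  rw [h, sub_eq_zero]
  exact ⟨fun h i => by rw [h]; rfl, fun h => PiLp.ext h⟩

/-- The eigenvalue equation is the recursion `x_i(k+1) = a x_i(k) - x_{i+1}(k)`, without the last
term in the last block, so the coordinates at `0` determine all others. -/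
theorem eigenspaceEval_injective (n : ℕ) (a : ℂ) : Function.Injective (eigenspaceEval n a) := by
  rw [← LinearMap.ker_eq_bot, LinearMap.ker_eq_bot']
  rintro ⟨x, hx⟩ h
  rw [mem_ker_adjoint_blockShift_iff] at hx
  have hk (k : ℕ) (i : Fin n) : x i k = 0 := by
    induction k generalizing i with
    | zero => exact congrFun h i
    | succ k ih =>
      have h1 := congrArg (fun y : EllTwo => y k) (hx i)
      simp only [EllTwo.smul_apply, ih, mul_zero] at h1
      rw [← adjoint_unilateralShift_apply]
      by_cases hi : (i : ℕ) + 1 < n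
      · rw [adjoint_blockShift_apply_of_succ x i ⟨i + 1, hi⟩ rfl, EllTwo.add_apply, ih,
          add_zero] at h1
        exact h1
      · rw [adjoint_blockShift_apply_last x i (by omega)] at h1
        exact h1
  refine Subtype.ext (PiLp.ext fun i => ?_)
  ext k
  exact hk k i

theorem eigenspaceEval_surjective (n : ℕ) {a : ℂ} (ha : ‖a‖ < 1) :
    Function.Surjective (eigenspaceEval n a) := by
  intro c
  choose f hf hf0 using exists_adjoint_unilateralShift_eq ha
  -- The prescribed values in reverse order; the default `0` is never reached when there is a block
  -- at all.
  let c' : ℕ → ℂ := fun d => if h : n - (d + 1) < n then c ⟨n - (d + 1), h⟩ else 0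
  -- Back substitution: `g d` is block `n - d` for `1 ≤ d ≤ n`, and `g 0 = 0` stands for the missing
  -- block `n` below the last row.
  let g : ℕ → EllTwo := fun d => Nat.rec 0 (fun d y => f y (c' d)) d
  have hg (d : ℕ) : g (d + 1) = f (g d) (c' d) := rfl
  let x : EllTwoPow n := WithLp.toLp 2 fun i => g (n - i)
  have hx (i : Fin n) : x i = f (g (n - (i + 1))) (c i) := by
    have h1 : n - (i : ℕ) = n - (i + 1) + 1 := by omega
    have h2 : c' (n - (i + 1)) = c i := by
      have h3 : n - (n - ((i : ℕ) + 1) + 1) = i := by omega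
      simp only [c', h3, i.2, dite_true]
    rw [← h2, ← hg, ← h1]
  refine ⟨⟨x, (mem_ker_adjoint_blockShift_iff a x).2 fun i => ?_⟩, funext fun i => ?_⟩
  · by_cases hi : (i : ℕ) + 1 < n
    · rw [adjoint_blockShift_apply_of_succ x i ⟨i + 1, hi⟩ rfl, hx i, hf]
      exact sub_add_cancel _ _
    · have h0 : g (n - (i + 1)) = 0 := by
        rw [show n - ((i : ℕ) + 1) = 0 by omega]
        rfl
      rw [adjoint_blockShift_apply_last x i (by omega), hx i, hf, h0, sub_zero]
  · change x i 0 = c i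
    rw [hx, hf0]

end BlockOperators

/-! ### The three families and their defects -/

section MainTheorem

open ContinuousLinearMap

variable {K : Type u} [NormedAddCommGroup K] [InnerProductSpace ℂ K]

theorem finite_and_finrank_ker_eq_zero {T : K →L[ℂ] K}
    (h : ∀ x, T x = 0 → x = 0) :
    FiniteDimensional ℂ (LinearMap.ker (T : K →ₗ[ℂ] K)) ∧
      Module.finrank ℂ (LinearMap.ker (T : K →ₗ[ℂ] K)) = 0 := by
  have hb : LinearMap.ker (T : K →ₗ[ℂ] K) = ⊥ := (Submodule.eq_bot_iff _).2 h
  rw [hb]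
  exact ⟨inferInstance, finrank_bot ℂ K⟩

theorem eq_smul_of_sub_apply_eq_zero {T : K →L[ℂ] K} {a : ℂ} {x : K}
    (h : (T - a • (1 : K →L[ℂ] K)) x = 0) : T x = a • x :=
  sub_eq_zero.1 h

theorem sub_smul_one_sub_one (T : K →L[ℂ] K) (a : ℝ) :
    T - (a : ℂ) • 1 - 1 = T - ((a + 1 : ℝ) : ℂ) • 1 := by
  push_cast
  rw [add_smul, one_smul, sub_sub]

theorem commute_of_commute_sub_smul_one {A T : K →L[ℂ] K} {a : ℂ}
    (h : Commute A (T - a • 1)) : Commute A T := by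
  have := h.add_right ((Commute.one_right A).smul_right a)
  rwa [sub_add_cancel] at this

variable [CompleteSpace K]

theorem adjoint_sub_smul_one (T : K →L[ℂ] K) (a : ℝ) :
    adjoint (T - (a : ℂ) • 1) = adjoint T - (a : ℂ) • 1 := by
  rw [← star_eq_adjoint, ← star_eq_adjoint, star_sub, star_smul, star_one]
  congr 2
  exact Complex.conj_ofReal a

variable [TopologicalSpace.SeparableSpace K]

/-- The case met by every family: the diagonal contributes nothing, so the defect is read off from
`ker T` and `ker T*`. -/
theorem SubspaceSystem.isQuasiFredholm_and_defect_ofOperator (T : K →L[ℂ] K) {d c : ℕ}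
    (hd : FiniteDimensional ℂ (LinearMap.ker (T : K →ₗ[ℂ] K)) ∧
      Module.finrank ℂ (LinearMap.ker (T : K →ₗ[ℂ] K)) = d)
    (hc : FiniteDimensional ℂ (LinearMap.ker (adjoint T : K →ₗ[ℂ] K)) ∧
      Module.finrank ℂ (LinearMap.ker (adjoint T : K →ₗ[ℂ] K)) = c)
    (h₁ : ∀ x, (T - 1) x = 0 → x = 0) (h₂ : ∀ x, (adjoint T - 1) x = 0 → x = 0) :
    (ofOperator T).IsQuasiFredholm ∧ (ofOperator T).defect = ((d : ℚ) - c) / 3 := by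
  have k₁ := finite_and_finrank_ker_eq_zero h₁
  have k₂ := finite_and_finrank_ker_eq_zero h₂
  refine ⟨isQuasiFredholm_ofOperator T hd.1 hc.1 k₁.1 k₂.1, ?_⟩
  rw [defect_ofOperator, hd.2, hc.2, k₁.2, k₂.2]
  push_cast
  ring

theorem not_isomorphic_sub_smul [Nontrivial K] (T : K →L[ℂ] K) {a b : ℝ} (hab : a ≠ b) :
    ¬ (SubspaceSystem.ofOperator (T - (a : ℂ) • 1)).Isomorphic
      (SubspaceSystem.ofOperator (T - (b : ℂ) • 1)) := by
  rw [sub_eq_add_neg, sub_eq_add_neg, ← neg_smul, ← neg_smul]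
  exact SubspaceSystem.not_isomorphic_add_smul T (fun h => hab (by
    exact_mod_cast neg_injective h))

theorem finite_and_finrank_ker_adjoint_blockShift (n : ℕ) {a : ℂ} (ha : ‖a‖ < 1) :
    FiniteDimensional ℂ (LinearMap.ker ((adjoint (blockShift n) - a • 1 :
      EllTwoPow n →L[ℂ] EllTwoPow n) : EllTwoPow n →ₗ[ℂ] EllTwoPow n)) ∧
    Module.finrank ℂ (LinearMap.ker ((adjoint (blockShift n) - a • 1 :
      EllTwoPow n →L[ℂ] EllTwoPow n) : EllTwoPow n →ₗ[ℂ] EllTwoPow n)) = n := by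
  let e := LinearEquiv.ofBijective (eigenspaceEval n a)
    ⟨eigenspaceEval_injective n a, eigenspaceEval_surjective n ha⟩
  exact ⟨e.symm.finiteDimensional, by rw [e.finrank_eq, Module.finrank_fin_fun]⟩

instance EllTwo.nontrivial : Nontrivial EllTwo :=
  ⟨⟨lp.single 2 0 1, 0, fun h => by
    have h1 : (lp.single 2 0 (1 : ℂ) : EllTwo) 0 = 0 := by rw [h]; rfl
    simp at h1⟩⟩

theorem EllTwoPow.nontrivial {n : ℕ} (hn : 0 < n) : Nontrivial (EllTwoPow n) := by
  obtain ⟨x, hx⟩ := exists_ne (0 : EllTwo)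
  refine ⟨⟨WithLp.toLp 2 fun _ => x, 0, fun h => hx ?_⟩⟩
  have h1 : (WithLp.toLp 2 fun _ => x : EllTwoPow n) ⟨0, hn⟩ = 0 := by rw [h]; rfl
  exact h1

theorem one_lt_norm_ofReal_add_one {α : ℝ} (hα : 0 < α) : 1 < ‖((α + 1 : ℝ) : ℂ)‖ := by
  rw [Complex.norm_real, Real.norm_of_nonneg (by linarith)]
  linarith

/-- The range of `α` places `α` inside the unit disc and away from `0`, and `α + 1` outside the
closed disc. -/
theorem blockShift_sub_smul_system {n : ℕ} (hn : 0 < n) {α : ℝ} (hα : α ∈ Set.Ioo (0 : ℝ) 1) :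
    (SubspaceSystem.ofOperator (blockShift n - (α : ℂ) • 1)).Indecomposable ∧
      (SubspaceSystem.ofOperator (blockShift n - (α : ℂ) • 1)).IsQuasiFredholm ∧
      (SubspaceSystem.ofOperator (blockShift n - (α : ℂ) • 1)).defect = -(n : ℚ) / 3 := by
  have h0 : (α : ℂ) ≠ 0 := by exact_mod_cast hα.1.ne'
  have h1 : ‖(α : ℂ)‖ < 1 := by
    rw [Complex.norm_real, Real.norm_of_nonneg hα.1.le]
    exact hα.2
  have h2 := one_lt_norm_ofReal_add_one hα.1
  refine ⟨SubspaceSystem.indecomposable_ofOperator fun A hA hc =>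
    eq_zero_or_one_of_commute_blockShift hn A hA (commute_of_commute_sub_smul_one hc), ?_⟩
  have h := SubspaceSystem.isQuasiFredholm_and_defect_ofOperator
    (blockShift n - (α : ℂ) • 1) (d := 0) (c := n)
    (finite_and_finrank_ker_eq_zero fun x hx =>
      eq_zero_of_blockShift_eq_smul h0 (eq_smul_of_sub_apply_eq_zero hx))
    (by
      rw [adjoint_sub_smul_one]
      exact finite_and_finrank_ker_adjoint_blockShift n h1)
    (fun x hx => by
      rw [sub_smul_one_sub_one] at hx
      exact eq_zero_of_blockShift_eq_smul (norm_pos_iff.1 (by linarith))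
        (eq_smul_of_sub_apply_eq_zero hx))
    (fun x hx => by
      rw [adjoint_sub_smul_one, sub_smul_one_sub_one] at hx
      exact eq_zero_of_adjoint_blockShift_eq_smul h2 (eq_smul_of_sub_apply_eq_zero hx))
  refine ⟨h.1, h.2.trans ?_⟩
  simp

theorem adjoint_blockShift_sub_smul_system {n : ℕ} (hn : 0 < n) {α : ℝ}
    (hα : α ∈ Set.Ioo (0 : ℝ) 1) :
    (SubspaceSystem.ofOperator (adjoint (blockShift n) - (α : ℂ) • 1)).Indecomposable ∧
      (SubspaceSystem.ofOperator (adjoint (blockShift n) - (α : ℂ) • 1)).IsQuasiFredholm ∧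
      (SubspaceSystem.ofOperator (adjoint (blockShift n) - (α : ℂ) • 1)).defect =
        (n : ℚ) / 3 := by
  have h0 : (α : ℂ) ≠ 0 := by exact_mod_cast hα.1.ne'
  have h1 : ‖(α : ℂ)‖ < 1 := by
    rw [Complex.norm_real, Real.norm_of_nonneg hα.1.le]
    exact hα.2
  have h2 := one_lt_norm_ofReal_add_one hα.1
  refine ⟨SubspaceSystem.indecomposable_ofOperator fun A hA hc => ?_, ?_⟩
  · have hc' : Commute (star A) (blockShift n) := by
      have h := (commute_of_commute_sub_smul_one hc).star_star
      rwa [← star_eq_adjoint, star_star] at h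
    rcases eq_zero_or_one_of_commute_blockShift hn (star A) (by rw [← star_mul, hA]) hc' with
      h | h
    · exact Or.inl (star_eq_zero.1 h)
    · exact Or.inr (by rw [← star_star A, h, star_one])
  · have h := SubspaceSystem.isQuasiFredholm_and_defect_ofOperator
      (adjoint (blockShift n) - (α : ℂ) • 1) (d := n) (c := 0)
      (finite_and_finrank_ker_adjoint_blockShift n h1)
      (by
        rw [adjoint_sub_smul_one, adjoint_adjoint]
        exact finite_and_finrank_ker_eq_zero fun x hx =>
          eq_zero_of_blockShift_eq_smul h0 (eq_smul_of_sub_apply_eq_zero hx))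
      (fun x hx => by
        rw [sub_smul_one_sub_one] at hx
        exact eq_zero_of_adjoint_blockShift_eq_smul h2 (eq_smul_of_sub_apply_eq_zero hx))
      (fun x hx => by
        rw [adjoint_sub_smul_one, adjoint_adjoint, sub_smul_one_sub_one] at hx
        exact eq_zero_of_blockShift_eq_smul (norm_pos_iff.1 (by linarith))
          (eq_smul_of_sub_apply_eq_zero hx))
    refine ⟨h.1, h.2.trans ?_⟩
    simp

theorem unilateralShift_add_smul_system {α : ℝ} (hα : α ∈ Set.Icc (0 : ℝ) 1) :
    (SubspaceSystem.ofOperator (unilateralShift + (3 : ℂ) • 1 + (α : ℂ) • 1)).Indecomposable ∧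
      (SubspaceSystem.ofOperator
        (unilateralShift + (3 : ℂ) • 1 + (α : ℂ) • 1)).IsQuasiFredholm ∧
      (SubspaceSystem.ofOperator (unilateralShift + (3 : ℂ) • 1 + (α : ℂ) • 1)).defect = 0 := by
  -- The shift is translated so far that both relevant points, `-(3 + α)` and `-(2 + α)`, have
  -- modulus greater than `1`; all four kernels then vanish.
  have hT : unilateralShift + (3 : ℂ) • 1 + (α : ℂ) • 1 =
      unilateralShift - ((-(3 + α) : ℝ) : ℂ) • 1 := by
    push_cast
    module
  have hα0 := hα.1
  have h1 : 1 < ‖((-(3 + α) : ℝ) : ℂ)‖ := by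
    rw [Complex.norm_real, norm_neg, Real.norm_of_nonneg (by linarith)]
    linarith
  have h2 : 1 < ‖((-(3 + α) + 1 : ℝ) : ℂ)‖ := by
    rw [Complex.norm_real, ← norm_neg, Real.norm_of_nonneg (by linarith)]
    linarith
  rw [hT]
  refine ⟨SubspaceSystem.indecomposable_ofOperator fun A hA hc =>
    eq_zero_or_one_of_commute_unilateralShift A hA (commute_of_commute_sub_smul_one hc), ?_⟩
  have h := SubspaceSystem.isQuasiFredholm_and_defect_ofOperator
    (unilateralShift - ((-(3 + α) : ℝ) : ℂ) • 1) (d := 0) (c := 0)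
    (finite_and_finrank_ker_eq_zero fun x hx =>
      eq_zero_of_unilateralShift_eq_smul (norm_pos_iff.1 (by linarith))
        (eq_smul_of_sub_apply_eq_zero hx))
    (by
      rw [adjoint_sub_smul_one]
      exact finite_and_finrank_ker_eq_zero fun x hx =>
        eq_zero_of_adjoint_unilateralShift_eq_smul h1 (eq_smul_of_sub_apply_eq_zero hx))
    (fun x hx => by
      rw [sub_smul_one_sub_one] at hx
      exact eq_zero_of_unilateralShift_eq_smul (norm_pos_iff.1 (by linarith))
        (eq_smul_of_sub_apply_eq_zero hx))
    (fun x hx => by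
      rw [adjoint_sub_smul_one, sub_smul_one_sub_one] at hx
      exact eq_zero_of_adjoint_unilateralShift_eq_smul h2 (eq_smul_of_sub_apply_eq_zero hx))
  refine ⟨h.1, h.2.trans ?_⟩
  simp

/-- A family of pairwise non-isomorphic systems over an uncountable index set has an uncountable
set of members. -/
theorem SubspaceSystem.exists_uncountable_family {s : Set ℝ} (hs : ¬ s.Countable)
    (f : ℝ → SubspaceSystem.{u} 4) {q : ℚ}
    (hf : ∀ α ∈ s, (f α).Indecomposable ∧ (f α).IsQuasiFredholm ∧ (f α).defect = q)
    (hni : ∀ α ∈ s, ∀ β ∈ s, α ≠ β → ¬ (f α).Isomorphic (f β)) :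
    ∃ F : Set (SubspaceSystem.{u} 4), ¬ F.Countable ∧
      (∀ 𝒮 ∈ F, 𝒮.Indecomposable ∧ 𝒮.IsQuasiFredholm ∧ 𝒮.defect = q) ∧
      (∀ 𝒮 ∈ F, ∀ 𝒯 ∈ F, 𝒮 ≠ 𝒯 → ¬ 𝒮.Isomorphic 𝒯) := by
  refine ⟨f '' s, fun h => hs ?_, ?_, ?_⟩
  -- Equal systems are isomorphic, so `f` is injective on `s`.
  · refine Set.countable_of_injective_of_countable_image (fun α hα β hβ hαβ => ?_) h
    by_contra hne
    exact hni α hα β hβ hne (hαβ ▸ Isomorphic.refl _)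
  · rintro _ ⟨α, hα, rfl⟩
    exact hf α hα
  · rintro _ ⟨α, hα, rfl⟩ _ ⟨β, hβ, rfl⟩ hne
    exact hni α hα β hβ fun h => hne (congrArg f h)

theorem not_countable_Ioo_zero_one : ¬ (Set.Ioo (0 : ℝ) 1).Countable := by
  rw [← Cardinal.le_aleph0_iff_set_countable, Cardinal.mk_Ioo_real zero_lt_one, not_le]
  exact Cardinal.aleph0_lt_continuum

theorem not_isomorphic_unilateralShift_add_smul {a b : ℝ} (hab : a ≠ b) :
    ¬ (SubspaceSystem.ofOperator (unilateralShift + (3 : ℂ) • 1 + (a : ℂ) • 1)).Isomorphic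
      (SubspaceSystem.ofOperator (unilateralShift + (3 : ℂ) • 1 + (b : ℂ) • 1)) :=
  SubspaceSystem.not_isomorphic_add_smul _ (by exact_mod_cast hab)

end MainTheorem

theorem mainTheorem12 :
    -- uncountable families of pairwise non-isomorphic indecomposable systems of any defect `n / 3`
    (∀ n : ℤ, ∃ F : Set (SubspaceSystem.{0} 4), ¬ F.Countable ∧
      (∀ 𝒮 ∈ F, 𝒮.Indecomposable ∧ 𝒮.IsQuasiFredholm ∧ 𝒮.defect = (n : ℚ) / 3) ∧
      (∀ 𝒮 ∈ F, ∀ 𝒯 ∈ F, 𝒮 ≠ 𝒯 → ¬ 𝒮.Isomorphic 𝒯)) ∧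
    -- explicit families for `-n / 3` and `n / 3`, where `n` is a positive integer
    (∀ n : ℕ, 0 < n →
      (∀ α ∈ Set.Ioo (0 : ℝ) 1,
        (SubspaceSystem.ofOperator (blockShift n - (α : ℂ) • 1)).Indecomposable ∧
        (SubspaceSystem.ofOperator (blockShift n - (α : ℂ) • 1)).IsQuasiFredholm ∧
        (SubspaceSystem.ofOperator (blockShift n - (α : ℂ) • 1)).defect = -(n : ℚ) / 3) ∧
      (∀ α ∈ Set.Ioo (0 : ℝ) 1, ∀ β ∈ Set.Ioo (0 : ℝ) 1, α ≠ β →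
        ¬ (SubspaceSystem.ofOperator (blockShift n - (α : ℂ) • 1)).Isomorphic
          (SubspaceSystem.ofOperator (blockShift n - (β : ℂ) • 1))) ∧
      (∀ α ∈ Set.Ioo (0 : ℝ) 1,
        (SubspaceSystem.ofOperator
          ((blockShift n).adjoint - (α : ℂ) • 1)).Indecomposable ∧
        (SubspaceSystem.ofOperator
          ((blockShift n).adjoint - (α : ℂ) • 1)).IsQuasiFredholm ∧
        (SubspaceSystem.ofOperator
          ((blockShift n).adjoint - (α : ℂ) • 1)).defect = (n : ℚ) / 3) ∧
      (∀ α ∈ Set.Ioo (0 : ℝ) 1, ∀ β ∈ Set.Ioo (0 : ℝ) 1, α ≠ β →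
        ¬ (SubspaceSystem.ofOperator ((blockShift n).adjoint - (α : ℂ) • 1)).Isomorphic
          (SubspaceSystem.ofOperator ((blockShift n).adjoint - (β : ℂ) • 1)))) ∧
    -- explicit family of defect `0`
    (∀ α ∈ Set.Icc (0 : ℝ) 1,
      (SubspaceSystem.ofOperator (unilateralShift + (3 : ℂ) • 1 + (α : ℂ) • 1)).Indecomposable ∧
      (SubspaceSystem.ofOperator (unilateralShift + (3 : ℂ) • 1 + (α : ℂ) • 1)).IsQuasiFredholm ∧
      (SubspaceSystem.ofOperator (unilateralShift + (3 : ℂ) • 1 + (α : ℂ) • 1)).defect = 0) ∧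
    (∀ α ∈ Set.Icc (0 : ℝ) 1, ∀ β ∈ Set.Icc (0 : ℝ) 1, α ≠ β →
      ¬ (SubspaceSystem.ofOperator (unilateralShift + (3 : ℂ) • 1 + (α : ℂ) • 1)).Isomorphic
        (SubspaceSystem.ofOperator (unilateralShift + (3 : ℂ) • 1 + (β : ℂ) • 1))) := by
  refine ⟨fun n => ?_, fun n hn => ?_, fun α hα => unilateralShift_add_smul_system hα,
    fun α _ β _ hαβ => not_isomorphic_unilateralShift_add_smul hαβ⟩
  · rcases lt_trichotomy n 0 with h | rfl | h
    · obtain ⟨m, hm⟩ := Int.eq_ofNat_of_zero_le (neg_nonneg.2 h.le)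
      have hm0 : 0 < m := by omega
      have hq : (n : ℚ) = -(m : ℚ) := by
        rw [← neg_eq_iff_eq_neg]
        exact_mod_cast hm
      have := EllTwoPow.nontrivial hm0
      rw [hq]
      exact SubspaceSystem.exists_uncountable_family not_countable_Ioo_zero_one _
        (fun α hα => blockShift_sub_smul_system hm0 hα)
        (fun α _ β _ hαβ => not_isomorphic_sub_smul _ hαβ)
    · have hI : ¬ (Set.Icc (0 : ℝ) 1).Countable := fun hc =>
        not_countable_Ioo_zero_one (hc.mono Set.Ioo_subset_Icc_self)
      rw [Int.cast_zero, zero_div]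
      exact SubspaceSystem.exists_uncountable_family hI _
        (fun α hα => unilateralShift_add_smul_system hα)
        (fun α _ β _ hαβ => not_isomorphic_unilateralShift_add_smul hαβ)
    · obtain ⟨m, rfl⟩ := Int.eq_ofNat_of_zero_le h.le
      have hm0 : 0 < m := by omega
      have := EllTwoPow.nontrivial hm0
      rw [Int.cast_natCast]
      exact SubspaceSystem.exists_uncountable_family not_countable_Ioo_zero_one _
        (fun α hα => adjoint_blockShift_sub_smul_system hm0 hα)
        (fun α _ β _ hαβ => not_isomorphic_sub_smul _ hαβ)
  · have := EllTwoPow.nontrivial hn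
    exact ⟨fun α hα => blockShift_sub_smul_system hn hα,
      fun α _ β _ hαβ => not_isomorphic_sub_smul _ hαβ,
      fun α hα => adjoint_blockShift_sub_smul_system hn hα,
      fun α _ β _ hαβ => not_isomorphic_sub_smul _ hαβ⟩
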